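/- For a tuple $\boldsymbol A=(A_1,\dots,A_d)$ of complex $n\times n$ matrices let $\|\boldsymbol A\|$ be the norm of the operator $x\mapsto(A_1x,\dots,A_dx)$ from $\mathbb C^n$ to $(\mathbb C^n)^d$ (all spaces with their Euclidean norms), let $\boldsymbol A^*\boldsymbol A=\sum_{j=1}^d A_j^*A_j$, and let $$\mathcal V(\boldsymbol A)=\{(\langle x|A_1x\rangle,\dots,\langle x|A_dx\rangle): x\in\mathbb C^n,\ \|x\|=1,\ \boldsymbol A^*\boldsymbol Ax=\|\boldsymbol A\|^2x\}\subseteq\mathbb C^d .$$ For a single matrix $X$ let $\|X\|$ be its operator norm and $\mathcal V(X)=\{\langle x|Xx\rangle:\|x\|=1,\ X^*Xx=\|X\|^2x\}\subseteq\mathbb C$. Let $\boldsymbol A$ be doubly commuting, that is, $A_iA_j=A_jA_i$ and $A_i^*A_j=A_jA_i^*$ for all $i\ne j$. Then: (a) $\mathcal V(\boldsymbol A)$ is convex. (b) $\boldsymbol A$ has a Bolotnikov–Rodman decomposition: there are an integer $\ell\ge 0$, positive integers $p_{j,k}$ and complex $p_{j,k}\times p_{j,k}$ matrices $X_{j,k}$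 ($1\le j\le d$, $1\le k\le\ell$) with $n=\sum_{k=1}^\ell p_{1,k}\cdots p_{d,k}$, and a unitary $n\times n$ matrix $U$, such that for every $j$ the matrix $UA_jU^*$ is block diagonal with diagonal blocks $$A_{j,k}=I_{p_{1,k}}\otimes\cdots\otimes I_{p_{j-1,k}}\otimes X_{j,k}\otimes I_{p_{j+1,k}}\otimes\cdots\otimes I_{p_{d,k}},\qquad 1\le k\le\ell .$$ (c) For every such decomposition, $$\mathcal V(\boldsymbol A)=\operatorname{conv}\bigcup\Big\{\prod_{j=1}^d\mathcal V(X_{j,k}) : 1\le k\le\ell,\ \sum_{j=1}^d\|X_{j,k}\|^2=\|\boldsymbol A\|^2\Big\},$$ where $\prod$ is the Cartesian product of sets. -/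

import Mathlib

noncomputable section

/-- The tuple `A = (A_1, …, A_d)` of matrices, seen as the operator `x ↦ (A_1 x, …, A_d x)` from
`ℂⁿ` to the Hilbert space direct sum of `d` copies of `ℂⁿ`. Its operator norm is `‖A‖`. -/
def tupleOp {ι κ : Type*} [Fintype ι] [DecidableEq ι] [Fintype κ]
    (A : κ → Matrix ι ι ℂ) :
    EuclideanSpace ℂ ι →L[ℂ] PiLp 2 (fun _ : κ => EuclideanSpace ℂ ι) :=
  ((PiLp.continuousLinearEquiv 2 ℂ (fun _ : κ => EuclideanSpace ℂ ι)).symm :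
      (κ → EuclideanSpace ℂ ι) →L[ℂ] PiLp 2 (fun _ : κ => EuclideanSpace ℂ ι)) ∘L
    ContinuousLinearMap.pi fun j => Matrix.toEuclideanCLM (𝕜 := ℂ) (A j)

/-- The set `V(A)` of all `(⟨x, A_1 x⟩, …, ⟨x, A_d x⟩)` with `‖x‖ = 1` and
`A^* A x = ‖A‖² x`. -/
def maximalRange {ι κ : Type*} [Fintype ι] [DecidableEq ι] [Fintype κ]
    (A : κ → Matrix ι ι ℂ) : Set (κ → ℂ) :=
  {z | ∃ x : EuclideanSpace ℂ ι, ‖x‖ = 1 ∧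
    ContinuousLinearMap.adjoint (tupleOp A) (tupleOp A x) = ((‖tupleOp A‖ ^ 2 : ℝ) : ℂ) • x ∧
    ∀ j, z j = inner ℂ x (Matrix.toEuclideanCLM (𝕜 := ℂ) (A j) x)}

/-- The set `V(X)` of a single matrix, as a set of complex numbers: all `⟨x, X x⟩` with
`‖x‖ = 1` and `X^* X x = ‖X‖² x`, where `‖X‖` is the operator norm. -/
def maximalRangeSingle {ι : Type*} [Fintype ι] [DecidableEq ι]
    (X : Matrix ι ι ℂ) : Set ℂ :=
  {z | ∃ x : EuclideanSpace ℂ ι, ‖x‖ = 1 ∧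
    ContinuousLinearMap.adjoint (Matrix.toEuclideanCLM (𝕜 := ℂ) X)
        (Matrix.toEuclideanCLM (𝕜 := ℂ) X x) =
      ((‖Matrix.toEuclideanCLM (𝕜 := ℂ) X‖ ^ 2 : ℝ) : ℂ) • x ∧
    z = inner ℂ x (Matrix.toEuclideanCLM (𝕜 := ℂ) X x)}

/-- Doubly commuting tuples: `A_i A_j = A_j A_i` and `A_i^* A_j = A_j A_i^*` for `i ≠ j`. -/
def DoublyCommuting {ι κ : Type*} [Fintype ι] (A : κ → Matrix ι ι ℂ) : Prop :=
  ∀ i j, i ≠ j → A i * A j = A j * A i ∧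
    (A i).conjTranspose * A j = A j * (A i).conjTranspose

/-- The Kronecker product `M_1 ⊗ ⋯ ⊗ M_d`, with rows and columns indexed by multi-indices. -/
def kroneckerFamily {d : ℕ} {p : Fin d → ℕ}
    (M : ∀ i, Matrix (Fin (p i)) (Fin (p i)) ℂ) :
    Matrix (∀ i, Fin (p i)) (∀ i, Fin (p i)) ℂ :=
  Matrix.of fun a b => ∏ i, M i (a i) (b i)

/-- `I ⊗ ⋯ ⊗ I ⊗ X ⊗ I ⊗ ⋯ ⊗ I`, with `X` in position `j`. -/
def kroneckerAt {d : ℕ} {p : Fin d → ℕ} (j : Fin d)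
    (X : Matrix (Fin (p j)) (Fin (p j)) ℂ) :
    Matrix (∀ i, Fin (p i)) (∀ i, Fin (p i)) ℂ :=
  kroneckerFamily (Function.update (fun i => (1 : Matrix (Fin (p i)) (Fin (p i)) ℂ)) j X)

/-- A Bolotnikov–Rodman decomposition of a tuple `A` of `n × n` matrices: a unitary `U` such that
every `U A_j U^*` is block diagonal with blocks
`A_{j,k} = I ⊗ ⋯ ⊗ X_{j,k} ⊗ ⋯ ⊗ I` (`X_{j,k}` in position `j`), `k = 1, …, ℓ`, where `X_{j,k}` has
size `p_{j,k} × p_{j,k}`. The bijection `e` numbers the rows of the block matrix by `1, …, n`; in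
particular `n = ∑ k, ∏ j, p_{j,k}`. -/
structure BRDecomposition {n d : ℕ} (A : Fin d → Matrix (Fin n) (Fin n) ℂ) where
  /-- the number of blocks -/
  l : ℕ
  /-- `p k j` is the size of the matrix `X_{j,k}` -/
  p : Fin l → Fin d → ℕ
  p_pos : ∀ k j, 0 < p k j
  /-- `X j k` is the matrix `X_{j,k}` -/
  X : ∀ (j : Fin d) (k : Fin l), Matrix (Fin (p k j)) (Fin (p k j)) ℂ
  U : Matrix (Fin n) (Fin n) ℂ
  U_unitary : U ∈ Matrix.unitaryGroup (Fin n) ℂ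
  e : Fin n ≃ (Σ k : Fin l, ∀ j : Fin d, Fin (p k j))
  eq_blockDiagonal : ∀ j : Fin d,
    Matrix.reindex e e (U * A j * U.conjTranspose) =
      Matrix.blockDiagonal' fun k : Fin l => kroneckerAt j (X j k)

end

/-! Formula (c): a vector satisfies the eigenvalue equation exactly when it attains the norm, so
`maximalRange` is a question about norming vectors. A decomposition makes the tuple block diagonal.
If `x` has blocks `x_k`, then `∑ j, ‖A_j x‖²` is at most `∑ k, (∑ j, ‖X_{j,k}‖²) ‖x_k‖²`, and each
inner sum is at most `‖A‖²`, as product vectors show. A unit norming `x` forces equality throughout: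
every nonzero block is a maximal one, and every slice of `x_k` along the `j`-th factor is norming
for `X_{j,k}`. Hence `⟨x_k, A_{j,k} x_k⟩` is `‖x_k‖²` times a convex combination of points of
`V(X_{j,k})`, which is convex by Toeplitz–Hausdorff on the norming subspace. Conversely, product
vectors weighted by square roots realise every point of the hull. Convexity (a) follows from (b) and
(c).

Existence (b), by induction on `d`: take a minimal reducing subspace `W` of the first operator and a
unit vector `w₀ ∈ W`. By Schur's lemma, `T w₀ ⊗ w ↦ T w`, with `T` in a star algebra `C` commuting
with that operator, is a well-defined isometry on `C w₀ ⊗ W`. The first operator acts on the factor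
`W`, the others on `C w₀`, where induction applies. The orthogonal complement is treated by
induction on dimension (`exists_reducing_hasTensorBlocks`, `hasTensorBlocks_of_isReducing`). -/

open scoped InnerProductSpace

/-! ### Norming vectors and the Toeplitz–Hausdorff theorem -/

section NumericalRange

variable {E F : Type*} [NormedAddCommGroup E] [InnerProductSpace ℂ E]
  [NormedAddCommGroup F] [InnerProductSpace ℂ F]

theorem inner_self_eq_ofReal (x : E) : ⟪x, x⟫_ℂ = ((‖x‖ ^ 2 : ℝ) : ℂ) := by
  rw [inner_self_eq_norm_sq_to_K, Complex.ofReal_pow]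
  rfl

/-- If the norm is attained, expanding `‖T* T x - ‖T‖² x‖²` and bounding `‖T* T x‖` by `‖T‖ ‖T x‖`
leaves at most zero. -/
theorem adjoint_apply_apply_eq_iff [CompleteSpace E] [CompleteSpace F] (T : E →L[ℂ] F) (x : E) :
    ContinuousLinearMap.adjoint T (T x) = ((‖T‖ ^ 2 : ℝ) : ℂ) • x ↔ ‖T x‖ = ‖T‖ * ‖x‖ := by
  constructor
  · intro h
    have h1 : ‖T x‖ ^ 2 = ‖T‖ ^ 2 * ‖x‖ ^ 2 := by
      have h2 : ⟪ContinuousLinearMap.adjoint T (T x), x⟫_ℂ = ⟪T x, T x⟫_ℂ :=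
        ContinuousLinearMap.adjoint_inner_left T x (T x)
      rw [h, inner_smul_left, Complex.conj_ofReal, inner_self_eq_ofReal,
        inner_self_eq_ofReal] at h2
      exact_mod_cast h2.symm
    rw [← mul_pow] at h1
    exact (sq_eq_sq₀ (norm_nonneg _) (by positivity)).1 h1
  · intro h
    have h0 : RCLike.re ⟪ContinuousLinearMap.adjoint T (T x), ((‖T‖ ^ 2 : ℝ) : ℂ) • x⟫_ℂ
        = ‖T‖ ^ 2 * ‖T x‖ ^ 2 := by
      rw [ContinuousLinearMap.adjoint_inner_left, map_smul, inner_smul_right,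
        inner_self_eq_ofReal, ← Complex.ofReal_mul]
      rfl
    have h1 := norm_sub_sq (𝕜 := ℂ) (ContinuousLinearMap.adjoint T (T x))
      (((‖T‖ ^ 2 : ℝ) : ℂ) • x)
    rw [h0, norm_smul, Complex.norm_real, Real.norm_of_nonneg (by positivity)] at h1
    have h2 : ‖ContinuousLinearMap.adjoint T (T x)‖ ≤ ‖T‖ * ‖T x‖ := by
      simpa using (ContinuousLinearMap.adjoint T).le_opNorm (T x)
    have h3 : ‖ContinuousLinearMap.adjoint T (T x)‖ ^ 2 ≤ (‖T‖ * ‖T x‖) ^ 2 := by gcongr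
    have h4 : ‖ContinuousLinearMap.adjoint T (T x) - ((‖T‖ ^ 2 : ℝ) : ℂ) • x‖ ^ 2 ≤ 0 := by
      rw [h1]
      rw [h] at h3 ⊢
      nlinarith
    have h5 : ‖ContinuousLinearMap.adjoint T (T x) - ((‖T‖ ^ 2 : ℝ) : ℂ) • x‖ = 0 := by
      nlinarith [norm_nonneg (ContinuousLinearMap.adjoint T (T x) - ((‖T‖ ^ 2 : ℝ) : ℂ) • x)]
    exact sub_eq_zero.1 (norm_eq_zero.1 h5)

/-- The vectors at which `T` attains its norm, with `0`. -/
noncomputable def normingSubspace [CompleteSpace E] [CompleteSpace F] (T : E →L[ℂ] F) : Submodule ℂ E :=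
  LinearMap.ker ((ContinuousLinearMap.adjoint T ∘L T : E →L[ℂ] E).toLinearMap -
    ((‖T‖ ^ 2 : ℝ) : ℂ) • LinearMap.id)

theorem mem_normingSubspace_iff [CompleteSpace E] [CompleteSpace F] (T : E →L[ℂ] F) (x : E) :
    x ∈ normingSubspace T ↔ ‖T x‖ = ‖T‖ * ‖x‖ := by
  rw [← adjoint_apply_apply_eq_iff, normingSubspace, LinearMap.mem_ker, LinearMap.sub_apply,
    sub_eq_zero]
  rfl

/-- `ω p + ω̄ q` and `ω (p - q̄)` have the same imaginary part, so `ω` is the conjugate phase of `p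
- q̄`. -/
theorem exists_unit_phase (p q : ℂ) : ∃ ω : ℂ, ‖ω‖ = 1 ∧ (ω * p + (starRingEnd ℂ) ω * q).im = 0 := by
  by_cases hs : p - (starRingEnd ℂ) q = 0
  · refine ⟨1, by simp, ?_⟩
    have := congrArg Complex.im hs
    simp at this ⊢
    linarith
  · set s := p - (starRingEnd ℂ) q with hsdef
    have hn : ‖s‖ ≠ 0 := norm_ne_zero_iff.2 hs
    refine ⟨(starRingEnd ℂ) s / ‖s‖, by simp [hn], ?_⟩
    have h1 : ((starRingEnd ℂ) s / ‖s‖ * s).im = 0 := by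
      have : (starRingEnd ℂ) s / ‖s‖ * s = ((‖s‖ : ℝ) : ℂ) := by
        have h2 : ((‖s‖ : ℝ) : ℂ) ≠ 0 := by exact_mod_cast hn
        field_simp
        rw [Complex.conj_mul']
      rw [this, Complex.ofReal_im]
    set ω := (starRingEnd ℂ) s / ‖s‖
    rw [hsdef, Complex.mul_im] at h1
    simp only [Complex.add_im, Complex.mul_im, Complex.conj_re, Complex.conj_im, Complex.sub_re,
      Complex.sub_im] at h1 ⊢
    linarith

/-- The **Toeplitz–Hausdorff theorem** for the compression of an operator to a subspace. -/
theorem convex_numericalRange (T : E →L[ℂ] E) (S : Submodule ℂ E) :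
    Convex ℝ {z : ℂ | ∃ x ∈ S, ‖x‖ = 1 ∧ z = ⟪x, T x⟫_ℂ} := by
  rintro a ⟨x, hxS, hx, rfl⟩ b ⟨y, hyS, hy, rfl⟩ s t hs ht hst
  obtain ⟨a, ha⟩ : ∃ a, a = ⟪x, T x⟫_ℂ := ⟨_, rfl⟩
  obtain ⟨b, hb⟩ : ∃ b, b = ⟪y, T y⟫_ℂ := ⟨_, rfl⟩
  rw [← ha, ← hb]
  by_cases hab : b - a = 0
  · have : b = a := sub_eq_zero.1 hab
    refine ⟨x, hxS, hx, ?_⟩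
    rw [this, ← add_smul, hst, one_smul, ha]
  -- Affine normalisation: the quadratic form of `B` is `0` at `x` and `1` at `y`.
  obtain ⟨B, hB⟩ : ∃ B : E →L[ℂ] E, B = (b - a)⁻¹ • (T - a • ContinuousLinearMap.id ℂ E) :=
    ⟨_, rfl⟩
  have hTB : ∀ v, ⟪v, T v⟫_ℂ = a * ⟪v, v⟫_ℂ + (b - a) * ⟪v, B v⟫_ℂ := by
    intro v
    simp only [hB, smul_apply, sub_apply,
      ContinuousLinearMap.id_apply, inner_smul_right, inner_sub_right]
    field_simp
    ring
  have hxx : ⟪x, x⟫_ℂ = 1 := by rw [inner_self_eq_ofReal, hx]; norm_num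
  have hyy : ⟪y, y⟫_ℂ = 1 := by rw [inner_self_eq_ofReal, hy]; norm_num
  have hxB : ⟪x, B x⟫_ℂ = 0 := by
    have := hTB x
    rw [hxx, ← ha] at this
    have h2 : (b - a) * ⟪x, B x⟫_ℂ = 0 := by linear_combination -this
    exact (mul_eq_zero.1 h2).resolve_left hab
  have hyB : ⟪y, B y⟫_ℂ = 1 := by
    have := hTB y
    rw [hyy, ← hb] at this
    have h2 : (b - a) * (⟪y, B y⟫_ℂ - 1) = 0 := by linear_combination -this
    exact sub_eq_zero.1 ((mul_eq_zero.1 h2).resolve_left hab)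
  -- Rotating `y` by `ω` makes the cross terms real, so the form of `B` is real along the segment
  -- from `x` to `ω y` and the intermediate value theorem applies.
  obtain ⟨ω, hω, him⟩ := exists_unit_phase ⟪x, B y⟫_ℂ ⟪y, B x⟫_ℂ
  have hωω : (starRingEnd ℂ) ω * ω = 1 := by rw [Complex.conj_mul', hω]; norm_num
  obtain ⟨h, hh⟩ : ∃ h : ℝ, (h : ℂ) = ω * ⟪x, B y⟫_ℂ + (starRingEnd ℂ) ω * ⟪y, B x⟫_ℂ :=
    ⟨_, Complex.ext rfl him.symm⟩
  obtain ⟨u, hu⟩ : ∃ u : ℝ → E, u = fun r => ((1 - r : ℝ) : ℂ) • x + (r : ℂ) • ω • y := ⟨_, rfl⟩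
  have huS : ∀ r, u r ∈ S := fun r => by
    rw [hu]
    exact S.add_mem (S.smul_mem _ hxS) (S.smul_mem _ (S.smul_mem _ hyS))
  have huB : ∀ r, ⟪u r, B (u r)⟫_ℂ = ((r ^ 2 + r * (1 - r) * h : ℝ) : ℂ) := by
    intro r
    have h1 : ((r ^ 2 + r * (1 - r) * h : ℝ) : ℂ)
        = (r : ℂ) ^ 2 + r * (1 - r) * (ω * ⟪x, B y⟫_ℂ + (starRingEnd ℂ) ω * ⟪y, B x⟫_ℂ) := by
      rw [← hh]; push_cast; ring
    rw [h1, hu]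
    simp only [map_add, map_smul, inner_add_left, inner_add_right, inner_smul_left,
      inner_smul_right, Complex.conj_ofReal, hxB, hyB]
    push_cast
    linear_combination (r : ℂ) ^ 2 * hωω
  -- If `u r = 0`, then `x` and `y` parts are opposite; comparing their values under `B` gives `r =
  -- 0`, hence `x = 0`.
  have hu0 : ∀ r, ‖u r‖ ≠ 0 := by
    intro r h0
    have h1 : ((1 - r : ℝ) : ℂ) • x = -((r : ℂ) • ω • y) := by
      have := norm_eq_zero.1 h0
      rw [hu] at this
      exact eq_neg_of_add_eq_zero_left this
    have h2 : ⟪((1 - r : ℝ) : ℂ) • x, B (((1 - r : ℝ) : ℂ) • x)⟫_ℂ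
        = ⟪-((r : ℂ) • ω • y), B (-((r : ℂ) • ω • y))⟫_ℂ := by rw [h1]
    simp only [map_smul, map_neg, inner_neg_left, inner_neg_right, inner_smul_left,
      inner_smul_right, Complex.conj_ofReal, hxB, hyB] at h2
    have h3 : (r : ℂ) ^ 2 = 0 := by linear_combination -h2 - (r : ℂ) ^ 2 * hωω
    have h4 : r = 0 := by exact_mod_cast pow_eq_zero_iff (two_ne_zero) |>.1 h3
    rw [h4] at h1
    simp only [sub_zero, Complex.ofReal_one, one_smul, Complex.ofReal_zero, zero_smul,
      neg_zero] at h1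
    rw [h1, norm_zero] at hx
    exact zero_ne_one hx
  have hcont : Continuous u := by rw [hu]; fun_prop
  obtain ⟨f, hf⟩ : ∃ f : ℝ → ℝ, f = fun r => (r ^ 2 + r * (1 - r) * h) / ‖u r‖ ^ 2 := ⟨_, rfl⟩
  have hfc : Continuous f := by
    rw [hf]
    refine Continuous.div (by fun_prop) (by fun_prop) fun r => pow_ne_zero _ (hu0 r)
  have hf0 : f 0 = 0 := by simp [hf]
  have hf1 : f 1 = 1 := by simp [hf, hu, norm_smul, hω, hy]
  obtain ⟨r, -, hr⟩ : t ∈ f '' Set.Icc 0 1 := by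
    apply intermediate_value_Icc zero_le_one hfc.continuousOn
    rw [hf0, hf1]
    exact ⟨ht, by linarith⟩
  refine ⟨((‖u r‖⁻¹ : ℝ) : ℂ) • u r, S.smul_mem _ (huS r), ?_, ?_⟩
  · rw [norm_smul, Complex.norm_real, norm_inv, norm_norm, inv_mul_cancel₀ (hu0 r)]
  · rw [map_smul, inner_smul_left, inner_smul_right, Complex.conj_ofReal, hTB, huB,
      inner_self_eq_ofReal]
    have h1 : (r ^ 2 + r * (1 - r) * h) = t * ‖u r‖ ^ 2 := by
      rw [← hr, hf]
      field_simp [hu0 r]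
    rw [h1]
    have h2 : ((‖u r‖ : ℝ) : ℂ) ≠ 0 := by exact_mod_cast hu0 r
    have h3 : (s : ℂ) = 1 - t := by
      rw [eq_sub_iff_add_eq]; exact_mod_cast hst
    rw [Complex.real_smul, Complex.real_smul, h3]
    push_cast
    field_simp
    ring

/-- The nonzero vectors are normalised and the squares of their norms become convex weights. -/
theorem sum_inner_mem_numericalRange (T : E →L[ℂ] E) (S : Submodule ℂ E) {ι : Type*} [Fintype ι]
    (x : ι → E) (hS : ∀ i, x i ∈ S) (h1 : ∑ i, ‖x i‖ ^ 2 = 1) :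
    ∑ i, ⟪x i, T (x i)⟫_ℂ ∈ {z : ℂ | ∃ x ∈ S, ‖x‖ = 1 ∧ z = ⟪x, T x⟫_ℂ} := by
  classical
  have hsub : ∀ f : ι → ℂ, (∀ i, x i = 0 → f i = 0) →
      ∑ i ∈ Finset.univ.filter (fun i => x i ≠ 0), f i = ∑ i, f i := by
    intro f hf
    apply Finset.sum_subset (Finset.subset_univ _)
    intro i _ hi
    exact hf i (by simpa using hi)
  have h2 : ∑ i ∈ Finset.univ.filter (fun i => x i ≠ 0), ‖x i‖ ^ 2 = 1 := by
    rw [← h1]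
    apply Finset.sum_subset (Finset.subset_univ _)
    intro i _ hi
    have : x i = 0 := by simpa using hi
    simp [this]
  have key := (convex_numericalRange T S).sum_mem (t := Finset.univ.filter (fun i => x i ≠ 0))
    (w := fun i => ‖x i‖ ^ 2)
    (z := fun i => ⟪((‖x i‖⁻¹ : ℝ) : ℂ) • x i, T (((‖x i‖⁻¹ : ℝ) : ℂ) • x i)⟫_ℂ)
    (fun i _ => by positivity) h2 (fun i hi => by
      have hi0 : x i ≠ 0 := by simpa using hi
      refine ⟨_, S.smul_mem _ (hS i), ?_, rfl⟩
      rw [norm_smul, Complex.norm_real, norm_inv, norm_norm,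
        inv_mul_cancel₀ (norm_ne_zero_iff.2 hi0)])
  convert key using 1
  rw [← hsub _ (fun i hi => by simp [hi])]
  refine Finset.sum_congr rfl fun i hi => ?_
  have hi0 : x i ≠ 0 := by simpa using hi
  have h3 : ((‖x i‖ : ℝ) : ℂ) ≠ 0 := by exact_mod_cast norm_ne_zero_iff.2 hi0
  rw [map_smul, inner_smul_left, inner_smul_right, Complex.conj_ofReal, Complex.real_smul]
  push_cast
  field_simp

theorem exists_unit_norm_apply_eq [FiniteDimensional ℂ E] [Nontrivial E] (T : E →L[ℂ] F) :
    ∃ x : E, ‖x‖ = 1 ∧ ‖T x‖ = ‖T‖ := by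
  have : ProperSpace E := FiniteDimensional.proper ℂ E
  obtain ⟨x0, hx0⟩ : ∃ x : E, ‖x‖ = 1 := by
    obtain ⟨v, hv⟩ := exists_ne (0 : E)
    exact ⟨((‖v‖⁻¹ : ℝ) : ℂ) • v, by
      rw [norm_smul, Complex.norm_real, norm_inv, norm_norm,
        inv_mul_cancel₀ (norm_ne_zero_iff.2 hv)]⟩
  obtain ⟨x, hx, hmax⟩ := (isCompact_sphere (0 : E) 1).exists_isMaxOn
    ⟨x0, by simpa using hx0⟩ (f := fun x => ‖T x‖) (by fun_prop)
  have hx1 : ‖x‖ = 1 := by simpa using hx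
  refine ⟨x, hx1, le_antisymm (by simpa [hx1] using T.le_opNorm x) ?_⟩
  refine T.opNorm_le_of_unit_norm (𝕜 := ℂ) (norm_nonneg _) fun y hy => ?_
  exact hmax (by simpa using hy)

end NumericalRange

/-! ### Maximal ranges through norm attainment -/

section MaximalRange

variable {ι κ : Type*} [Fintype ι] [DecidableEq ι] [Fintype κ]

theorem norm_tupleOp_apply_sq (A : κ → Matrix ι ι ℂ) (x : EuclideanSpace ℂ ι) :
    ‖tupleOp A x‖ ^ 2 = ∑ j, ‖Matrix.toEuclideanCLM (𝕜 := ℂ) (A j) x‖ ^ 2 := by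
  rw [PiLp.norm_sq_eq_of_L2]
  rfl

theorem mem_maximalRange_iff (A : κ → Matrix ι ι ℂ) (z : κ → ℂ) :
    z ∈ maximalRange A ↔ ∃ x : EuclideanSpace ℂ ι, ‖x‖ = 1 ∧
      ∑ j, ‖Matrix.toEuclideanCLM (𝕜 := ℂ) (A j) x‖ ^ 2 = ‖tupleOp A‖ ^ 2 ∧
      ∀ j, z j = ⟪x, Matrix.toEuclideanCLM (𝕜 := ℂ) (A j) x⟫_ℂ := by
  refine exists_congr fun x => and_congr_right fun hx => and_congr_left fun _ => ?_
  rw [adjoint_apply_apply_eq_iff, hx, mul_one, ← norm_tupleOp_apply_sq,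
    sq_eq_sq₀ (norm_nonneg _) (norm_nonneg _)]

theorem mem_maximalRangeSingle_iff (X : Matrix ι ι ℂ) (z : ℂ) :
    z ∈ maximalRangeSingle X ↔ ∃ x : EuclideanSpace ℂ ι, ‖x‖ = 1 ∧
      ‖Matrix.toEuclideanCLM (𝕜 := ℂ) X x‖ = ‖Matrix.toEuclideanCLM (𝕜 := ℂ) X‖ ∧
      z = ⟪x, Matrix.toEuclideanCLM (𝕜 := ℂ) X x⟫_ℂ := by
  refine exists_congr fun x => and_congr_right fun hx => and_congr_left fun _ => ?_
  rw [adjoint_apply_apply_eq_iff, hx, mul_one]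

theorem maximalRangeSingle_eq (X : Matrix ι ι ℂ) :
    maximalRangeSingle X = {z : ℂ | ∃ x ∈ normingSubspace (Matrix.toEuclideanCLM (𝕜 := ℂ) X),
      ‖x‖ = 1 ∧ z = ⟪x, Matrix.toEuclideanCLM (𝕜 := ℂ) X x⟫_ℂ} := by
  ext z
  rw [mem_maximalRangeSingle_iff]
  refine exists_congr fun x => ?_
  rw [mem_normingSubspace_iff]
  constructor
  · rintro ⟨h1, h2, h3⟩
    exact ⟨by rw [h1, mul_one, h2], h1, h3⟩
  · rintro ⟨h1, h2, h3⟩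
    exact ⟨h2, by rw [h1, h2, mul_one], h3⟩

/-- Termwise `‖X x_r‖² ≤ ‖X‖² ‖x_r‖²`, and the totals agree; so every `x_r` lies in the norming
subspace. -/
theorem sum_inner_mem_maximalRangeSingle (X : Matrix ι ι ℂ) {ρ : Type*} [Fintype ρ]
    (x : ρ → EuclideanSpace ℂ ι) (h1 : ∑ r, ‖x r‖ ^ 2 = 1)
    (hX : ∑ r, ‖Matrix.toEuclideanCLM (𝕜 := ℂ) X (x r)‖ ^ 2 =
      ‖Matrix.toEuclideanCLM (𝕜 := ℂ) X‖ ^ 2) :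
    ∑ r, ⟪x r, Matrix.toEuclideanCLM (𝕜 := ℂ) X (x r)⟫_ℂ ∈ maximalRangeSingle X := by
  rw [maximalRangeSingle_eq]
  refine sum_inner_mem_numericalRange _ _ x (fun r => ?_) h1
  rw [mem_normingSubspace_iff]
  obtain ⟨T, hT⟩ : ∃ T, T = Matrix.toEuclideanCLM (𝕜 := ℂ) X := ⟨_, rfl⟩
  rw [← hT] at hX ⊢
  have hle : ∀ r ∈ Finset.univ, ‖T (x r)‖ ^ 2 ≤ (‖T‖ * ‖x r‖) ^ 2 := fun r _ => by
    gcongr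
    exact T.le_opNorm _
  have heq : ∑ r, ‖T (x r)‖ ^ 2 = ∑ r, (‖T‖ * ‖x r‖) ^ 2 := by
    simp_rw [mul_pow]
    rw [← Finset.mul_sum, h1, hX, mul_one]
  have := (Finset.sum_eq_sum_iff_of_le hle).1 heq r (Finset.mem_univ _)
  exact (sq_eq_sq₀ (norm_nonneg _) (by positivity)).1 this

theorem maximalRange_eq_of_intertwining {ι' : Type*} [Fintype ι'] [DecidableEq ι']
    (A : κ → Matrix ι ι ℂ) (B : κ → Matrix ι' ι' ℂ)
    (u : EuclideanSpace ℂ ι' ≃ₗᵢ[ℂ] EuclideanSpace ℂ ι)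
    (h : ∀ j x, Matrix.toEuclideanCLM (𝕜 := ℂ) (A j) (u x) =
      u (Matrix.toEuclideanCLM (𝕜 := ℂ) (B j) x)) :
    ‖tupleOp A‖ = ‖tupleOp B‖ ∧ maximalRange A = maximalRange B := by
  have hx : ∀ x, ‖tupleOp A (u x)‖ = ‖tupleOp B x‖ := fun x => by
    rw [← sq_eq_sq₀ (norm_nonneg _) (norm_nonneg _), norm_tupleOp_apply_sq, norm_tupleOp_apply_sq]
    simp_rw [h, LinearIsometryEquiv.norm_map]
  have hn : ‖tupleOp A‖ = ‖tupleOp B‖ := by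
    apply le_antisymm
    · refine ContinuousLinearMap.opNorm_le_bound _ (norm_nonneg _) fun x => ?_
      have h1 := hx (u.symm x)
      rw [u.apply_symm_apply] at h1
      rw [h1]
      simpa using (tupleOp B).le_opNorm (u.symm x)
    · refine ContinuousLinearMap.opNorm_le_bound _ (norm_nonneg _) fun x => ?_
      rw [← hx]
      simpa using (tupleOp A).le_opNorm (u x)
  refine ⟨hn, ?_⟩
  ext z
  rw [mem_maximalRange_iff, mem_maximalRange_iff, u.surjective.exists]
  simp_rw [h, LinearIsometryEquiv.norm_map, LinearIsometryEquiv.inner_map_map, hn]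

end MaximalRange

/-! ### One-factor operators on a tensor product -/

section KroneckerAt

variable {d : ℕ} {p : Fin d → ℕ}

theorem kroneckerAt_apply (j : Fin d) (X : Matrix (Fin (p j)) (Fin (p j)) ℂ)
    (a b : ∀ i, Fin (p i)) :
    kroneckerAt j X a b = if ∀ i, i ≠ j → a i = b i then X (a j) (b j) else 0 := by
  rw [kroneckerAt, kroneckerFamily, Matrix.of_apply]
  split_ifs with h
  · rw [Finset.prod_eq_single j]
    · rw [Function.update_self]
    · intro i _ hi
      rw [Function.update_of_ne hi, h i hi, Matrix.one_apply_eq]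
    · intro hj
      exact absurd (Finset.mem_univ j) hj
  · push Not at h
    obtain ⟨i, hi, hne⟩ := h
    exact Finset.prod_eq_zero (Finset.mem_univ i)
      (by rw [Function.update_of_ne hi, Matrix.one_apply_ne hne])

theorem kroneckerAt_mulVec (j : Fin d) (X : Matrix (Fin (p j)) (Fin (p j)) ℂ)
    (f : (∀ i, Fin (p i)) → ℂ) (a : ∀ i, Fin (p i)) :
    (kroneckerAt j X).mulVec f a = ∑ c, X (a j) c * f (Function.update a j c) := by
  symm
  refine Finset.sum_of_injOn (fun c => Function.update a j c)
    (fun c _ c' _ h => Function.update_injective a j h) (by simp) ?_ ?_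
  · intro b _ hb
    change kroneckerAt j X a b * f b = 0
    rw [kroneckerAt_apply, if_neg, zero_mul]
    intro h
    refine hb ⟨b j, by simp, ?_⟩
    funext i
    by_cases hi : i = j
    · subst hi
      simp
    · simp [Function.update_of_ne hi, h i hi]
  · intro c _
    change _ = kroneckerAt j X a (Function.update a j c) * f (Function.update a j c)
    rw [kroneckerAt_apply, if_pos, Function.update_self]
    intro i hi
    rw [Function.update_of_ne hi]

/-- The slices of a vector of a tensor product in the direction of the `j`-th factor. -/
noncomputable def slice (j : Fin d) (ξ : EuclideanSpace ℂ (∀ i, Fin (p i)))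
    (r : ∀ i : {i // i ≠ j}, Fin (p i)) : EuclideanSpace ℂ (Fin (p j)) :=
  WithLp.toLp 2 fun c => ξ ((Equiv.piSplitAt j fun i => Fin (p i)).symm (c, r))

theorem update_piSplitAt_symm (j : Fin d) (r : ∀ i : {i // i ≠ j}, Fin (p i)) (c c' : Fin (p j)) :
    Function.update ((Equiv.piSplitAt j fun i => Fin (p i)).symm (c, r)) j c' =
      (Equiv.piSplitAt j fun i => Fin (p i)).symm (c', r) := by
  funext i
  by_cases hi : i = j
  · subst hi
    simp [Equiv.piSplitAt]
  · simp [Equiv.piSplitAt, hi]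

/-- With the `j`-th factor split off, the tensor product is a direct sum of copies of that factor,
and the operator acts as `X` on each copy. -/
theorem slice_kroneckerAt (j : Fin d) (X : Matrix (Fin (p j)) (Fin (p j)) ℂ)
    (ξ : EuclideanSpace ℂ (∀ i, Fin (p i))) (r : ∀ i : {i // i ≠ j}, Fin (p i)) :
    slice j (Matrix.toEuclideanCLM (𝕜 := ℂ) (kroneckerAt j X) ξ) r =
      Matrix.toEuclideanCLM (𝕜 := ℂ) X (slice j ξ r) := by
  ext c
  change (kroneckerAt j X).mulVec (WithLp.ofLp ξ) _ = X.mulVec (WithLp.ofLp (slice j ξ r)) c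
  rw [kroneckerAt_mulVec]
  simp only [update_piSplitAt_symm, Matrix.mulVec, dotProduct]
  refine Finset.sum_congr rfl fun c' _ => ?_
  have : ((Equiv.piSplitAt j fun i => Fin (p i)).symm (c, r)) j = c := by
    simp [Equiv.piSplitAt]
  rw [this]
  rfl

theorem inner_eq_sum_slice (j : Fin d) (ξ η : EuclideanSpace ℂ (∀ i, Fin (p i))) :
    ⟪ξ, η⟫_ℂ = ∑ r, ⟪slice j ξ r, slice j η r⟫_ℂ := by
  simp only [PiLp.inner_apply]
  rw [← (Equiv.piSplitAt j fun i => Fin (p i)).symm.sum_comp, Fintype.sum_prod_type_right]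
  rfl

theorem norm_sq_eq_sum_slice (j : Fin d) (ξ : EuclideanSpace ℂ (∀ i, Fin (p i))) :
    ‖ξ‖ ^ 2 = ∑ r, ‖slice j ξ r‖ ^ 2 := by
  have h := inner_eq_sum_slice j ξ ξ
  simp only [inner_self_eq_ofReal] at h
  exact_mod_cast h

theorem norm_kroneckerAt_apply_le (j : Fin d) (X : Matrix (Fin (p j)) (Fin (p j)) ℂ)
    (ξ : EuclideanSpace ℂ (∀ i, Fin (p i))) :
    ‖Matrix.toEuclideanCLM (𝕜 := ℂ) (kroneckerAt j X) ξ‖ ^ 2 ≤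
      ‖Matrix.toEuclideanCLM (𝕜 := ℂ) X‖ ^ 2 * ‖ξ‖ ^ 2 := by
  rw [norm_sq_eq_sum_slice j, norm_sq_eq_sum_slice j ξ, Finset.mul_sum]
  refine Finset.sum_le_sum fun r _ => ?_
  rw [slice_kroneckerAt, ← mul_pow]
  gcongr
  exact ContinuousLinearMap.le_opNorm _ _

theorem inner_kroneckerAt_mem_maximalRangeSingle (j : Fin d)
    (X : Matrix (Fin (p j)) (Fin (p j)) ℂ) (ξ : EuclideanSpace ℂ (∀ i, Fin (p i)))
    (hξ : ‖ξ‖ ^ 2 = 1) (hX : ‖Matrix.toEuclideanCLM (𝕜 := ℂ) (kroneckerAt j X) ξ‖ ^ 2 =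
      ‖Matrix.toEuclideanCLM (𝕜 := ℂ) X‖ ^ 2) :
    ⟪ξ, Matrix.toEuclideanCLM (𝕜 := ℂ) (kroneckerAt j X) ξ⟫_ℂ ∈ maximalRangeSingle X := by
  rw [norm_sq_eq_sum_slice j] at hξ hX
  rw [inner_eq_sum_slice j]
  simp only [slice_kroneckerAt] at hX ⊢
  exact sum_inner_mem_maximalRangeSingle X _ hξ hX

/-- The tensor product of a family of vectors. -/
noncomputable def tensorVector (y : ∀ i, EuclideanSpace ℂ (Fin (p i))) :
    EuclideanSpace ℂ (∀ i, Fin (p i)) :=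
  WithLp.toLp 2 fun a => ∏ i, y i (a i)

theorem norm_tensorVector (y : ∀ i, EuclideanSpace ℂ (Fin (p i))) :
    ‖tensorVector y‖ ^ 2 = ∏ i, ‖y i‖ ^ 2 := by
  simp only [EuclideanSpace.norm_sq_eq, tensorVector, norm_prod]
  rw [Finset.prod_univ_sum, Fintype.piFinset_univ]
  simp only [Finset.prod_pow]

theorem slice_tensorVector (j : Fin d) (y : ∀ i, EuclideanSpace ℂ (Fin (p i)))
    (r : ∀ i : {i // i ≠ j}, Fin (p i)) :
    slice j (tensorVector y) r = (∏ i : {i // i ≠ j}, y i (r i)) • y j := by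
  ext c
  change ∏ i, y i (((Equiv.piSplitAt j fun i => Fin (p i)).symm (c, r)) i) =
    (∏ i : {i // i ≠ j}, y i (r i)) * y j c
  rw [Fintype.prod_eq_mul_prod_subtype_ne _ j, mul_comm]
  congr 1
  · refine Finset.prod_congr rfl fun i _ => ?_
    simp [Equiv.piSplitAt, i.2]
  · simp [Equiv.piSplitAt]

theorem sum_norm_sq_tensorVector (j : Fin d) (y : ∀ i, EuclideanSpace ℂ (Fin (p i)))
    (hy : ∀ i, ‖y i‖ = 1) :
    ∑ r : ∀ i : {i // i ≠ j}, Fin (p i), ‖∏ i : {i // i ≠ j}, y i (r i)‖ ^ 2 = 1 := by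
  have h := norm_sq_eq_sum_slice j (tensorVector y)
  simp only [slice_tensorVector, norm_smul, hy, mul_one, norm_tensorVector] at h
  simpa using h.symm

theorem norm_kroneckerAt_tensorVector (j : Fin d) (X : Matrix (Fin (p j)) (Fin (p j)) ℂ)
    (y : ∀ i, EuclideanSpace ℂ (Fin (p i))) (hy : ∀ i, ‖y i‖ = 1) :
    ‖Matrix.toEuclideanCLM (𝕜 := ℂ) (kroneckerAt j X) (tensorVector y)‖ ^ 2 =
      ‖Matrix.toEuclideanCLM (𝕜 := ℂ) X (y j)‖ ^ 2 := by
  rw [norm_sq_eq_sum_slice j]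
  simp only [slice_kroneckerAt, slice_tensorVector, map_smul, norm_smul, mul_pow]
  rw [← Finset.sum_mul, sum_norm_sq_tensorVector j y hy, one_mul]

theorem inner_kroneckerAt_tensorVector (j : Fin d) (X : Matrix (Fin (p j)) (Fin (p j)) ℂ)
    (y : ∀ i, EuclideanSpace ℂ (Fin (p i))) (hy : ∀ i, ‖y i‖ = 1) :
    ⟪tensorVector y, Matrix.toEuclideanCLM (𝕜 := ℂ) (kroneckerAt j X) (tensorVector y)⟫_ℂ =
      ⟪y j, Matrix.toEuclideanCLM (𝕜 := ℂ) X (y j)⟫_ℂ := by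
  rw [inner_eq_sum_slice j]
  simp only [slice_kroneckerAt, slice_tensorVector, map_smul, inner_smul_left, inner_smul_right]
  simp only [← mul_assoc, Complex.mul_conj']
  rw [← Finset.sum_mul]
  have h := sum_norm_sq_tensorVector j y hy
  have h' : ∑ r : ∀ i : {i // i ≠ j}, Fin (p i),
      ((‖∏ i : {i // i ≠ j}, y i (r i)‖ : ℝ) : ℂ) ^ 2 = 1 := by exact_mod_cast h
  rw [h', one_mul]

end KroneckerAt

/-! ### Block diagonal operators -/

section BlockDiagonal

variable {K : Type*} [Fintype K] {m : K → Type*} [∀ k, Fintype (m k)]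

/-- The component of a vector in the `k`-th block. -/
noncomputable def blockPart (x : EuclideanSpace ℂ (Σ k, m k)) (k : K) : EuclideanSpace ℂ (m k) :=
  WithLp.toLp 2 fun a => x ⟨k, a⟩

theorem inner_eq_sum_blockPart (x y : EuclideanSpace ℂ (Σ k, m k)) :
    ⟪x, y⟫_ℂ = ∑ k, ⟪blockPart x k, blockPart y k⟫_ℂ := by
  simp only [PiLp.inner_apply]
  rw [Fintype.sum_sigma]
  rfl

theorem norm_sq_eq_sum_blockPart (x : EuclideanSpace ℂ (Σ k, m k)) :
    ‖x‖ ^ 2 = ∑ k, ‖blockPart x k‖ ^ 2 := by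
  have h := inner_eq_sum_blockPart x x
  simp only [inner_self_eq_ofReal] at h
  exact_mod_cast h

theorem blockPart_blockDiagonal' [DecidableEq K] [∀ k, DecidableEq (m k)]
    (M : ∀ k, Matrix (m k) (m k) ℂ)
    (x : EuclideanSpace ℂ (Σ k, m k)) (k : K) :
    blockPart (Matrix.toEuclideanCLM (𝕜 := ℂ) (Matrix.blockDiagonal' M) x) k =
      Matrix.toEuclideanCLM (𝕜 := ℂ) (M k) (blockPart x k) := by
  ext a
  change (Matrix.blockDiagonal' M).mulVec (WithLp.ofLp x) ⟨k, a⟩ =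
    (M k).mulVec (WithLp.ofLp (blockPart x k)) a
  simp only [Matrix.mulVec, dotProduct]
  rw [Fintype.sum_sigma, Finset.sum_eq_single k]
  · simp only [Matrix.blockDiagonal'_apply_eq]
    rfl
  · intro k' _ hk'
    exact Finset.sum_eq_zero fun b _ => by
      rw [Matrix.blockDiagonal'_apply_ne _ _ _ hk'.symm, zero_mul]
  · intro hk
    exact absurd (Finset.mem_univ k) hk

end BlockDiagonal

/-! ### Equality in sums and hulls of unions of convex sets -/

theorem eq_of_sum_eq_of_le {K : Type*} [Fintype K] (f g : K → ℝ) (hle : ∀ k, f k ≤ g k)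
    (h : ∑ k, f k = ∑ k, g k) (k : K) : f k = g k :=
  (Finset.sum_eq_sum_iff_of_le fun k _ => hle k).1 h k (Finset.mem_univ k)

/-- The points of a convex combination are grouped by piece and each group is replaced by its centre
of mass. A group of weight zero has no meaningful centre, hence the condition `t k ≠ 0`. -/
theorem mem_convexHull_biUnion {E K : Type*} [AddCommGroup E] [Module ℝ E] [Fintype K]
    (S : Set K) (P : K → Set E) (hP : ∀ k, Convex ℝ (P k)) {z : E}
    (hz : z ∈ convexHull ℝ (⋃ k ∈ S, P k)) :
    ∃ (t : K → ℝ) (ζ : K → E), (∀ k, 0 ≤ t k) ∧ ∑ k, t k = 1 ∧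
      (∀ k, t k ≠ 0 → k ∈ S ∧ ζ k ∈ P k) ∧ z = ∑ k, t k • ζ k := by
  classical
  obtain ⟨ι, _, w, y, hw0, hw1, hy, rfl⟩ := mem_convexHull_iff_exists_fintype.1 hz
  simp only [Set.mem_iUnion, exists_prop] at hy
  choose g hg hyg using hy
  refine ⟨fun k => ∑ i with g i = k, w i, fun k => (Finset.univ.filter (g · = k)).centerMass w y,
    fun k => Finset.sum_nonneg fun i _ => hw0 i, ?_, ?_, ?_⟩
  · exact (Finset.sum_fiberwise _ _ _).trans hw1
  · intro k hk
    have hpos : 0 < ∑ i with g i = k, w i :=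
      lt_of_le_of_ne (Finset.sum_nonneg fun i _ => hw0 i) (Ne.symm hk)
    constructor
    · obtain ⟨i, hi, -⟩ := Finset.exists_ne_zero_of_sum_ne_zero hk
      rw [← (Finset.mem_filter.1 hi).2]
      exact hg i
    · refine (hP k).centerMass_mem (fun i _ => hw0 i) hpos fun i hi => ?_
      rw [← (Finset.mem_filter.1 hi).2]
      exact hyg i
  · rw [← Finset.sum_fiberwise Finset.univ g]
    refine Finset.sum_congr rfl fun k _ => ?_
    by_cases hk : ∑ i with g i = k, w i = 0
    · simp only [hk, zero_smul]
      refine Finset.sum_eq_zero fun i hi => ?_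
      rw [(Finset.sum_eq_zero_iff_of_nonneg fun i _ => hw0 i).1 hk i hi, zero_smul]
    · simp only [Finset.centerMass, smul_smul, mul_inv_cancel₀ hk, one_smul]

theorem convex_maximalRangeSingle {ι : Type*} [Fintype ι] [DecidableEq ι] (X : Matrix ι ι ℂ) :
    Convex ℝ (maximalRangeSingle X) := by
  rw [maximalRangeSingle_eq]
  exact convex_numericalRange _ _

/-! ### The range formula for block diagonal tuples -/

section BlockKronecker

variable {d : ℕ} {K : Type*} [Fintype K] [DecidableEq K] {p : K → Fin d → ℕ}

/-- The tuple of block diagonal matrices with blocks `I ⊗ ⋯ ⊗ X j k ⊗ ⋯ ⊗ I`. -/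
noncomputable def blockKronecker (X : ∀ (j : Fin d) (k : K), Matrix (Fin (p k j)) (Fin (p k j)) ℂ)
    (j : Fin d) : Matrix (Σ k, ∀ j, Fin (p k j)) (Σ k, ∀ j, Fin (p k j)) ℂ :=
  Matrix.blockDiagonal' fun k => kroneckerAt j (X j k)

variable (X : ∀ (j : Fin d) (k : K), Matrix (Fin (p k j)) (Fin (p k j)) ℂ)

theorem norm_blockKronecker_apply (j : Fin d) (x : EuclideanSpace ℂ (Σ k, ∀ j, Fin (p k j))) :
    ‖Matrix.toEuclideanCLM (𝕜 := ℂ) (blockKronecker X j) x‖ ^ 2 =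
      ∑ k, ‖Matrix.toEuclideanCLM (𝕜 := ℂ) (kroneckerAt j (X j k)) (blockPart x k)‖ ^ 2 := by
  rw [norm_sq_eq_sum_blockPart]
  simp only [blockKronecker, blockPart_blockDiagonal']

theorem inner_blockKronecker_apply (j : Fin d) (x : EuclideanSpace ℂ (Σ k, ∀ j, Fin (p k j))) :
    ⟪x, Matrix.toEuclideanCLM (𝕜 := ℂ) (blockKronecker X j) x⟫_ℂ =
      ∑ k, ⟪blockPart x k,
        Matrix.toEuclideanCLM (𝕜 := ℂ) (kroneckerAt j (X j k)) (blockPart x k)⟫_ℂ := by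
  rw [inner_eq_sum_blockPart]
  simp only [blockKronecker, blockPart_blockDiagonal']

/-- Tested on the product of unit norming vectors of the `X j k`, placed in block `k`; positive
sizes ensure that these exist. -/
theorem sum_norm_sq_le_norm_tupleOp_blockKronecker (hp : ∀ k j, 0 < p k j) (k : K) :
    ∑ j, ‖Matrix.toEuclideanCLM (𝕜 := ℂ) (X j k)‖ ^ 2 ≤ ‖tupleOp (blockKronecker X)‖ ^ 2 := by
  have hne : ∀ j, ∃ y : EuclideanSpace ℂ (Fin (p k j)), ‖y‖ = 1 ∧
      ‖Matrix.toEuclideanCLM (𝕜 := ℂ) (X j k) y‖ = ‖Matrix.toEuclideanCLM (𝕜 := ℂ) (X j k)‖ := by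
    intro j
    have : Nonempty (Fin (p k j)) := ⟨⟨0, hp k j⟩⟩
    exact exists_unit_norm_apply_eq _
  choose y hy hyX using hne
  obtain ⟨x, hx⟩ : ∃ x : EuclideanSpace ℂ (Σ k, ∀ j, Fin (p k j)),
      ∀ k', blockPart x k' = if h : k' = k then h ▸ tensorVector y else 0 :=
    ⟨WithLp.toLp 2 fun s => (if h : s.1 = k then h ▸ tensorVector y else 0 :
      EuclideanSpace ℂ (∀ j, Fin (p s.1 j))) s.2, fun _ => rfl⟩
  have hxk : blockPart x k = tensorVector y := by simp [hx]
  have hxk' : ∀ k', k' ≠ k → blockPart x k' = 0 := fun k' h => by simp [hx, h]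
  have hx1 : ‖x‖ ^ 2 = 1 := by
    rw [norm_sq_eq_sum_blockPart, Finset.sum_eq_single k (fun k' _ h => by simp [hxk' k' h])
      (by simp), hxk, norm_tensorVector]
    simp [hy]
  have hB : ‖tupleOp (blockKronecker X) x‖ ^ 2 =
      ∑ j, ‖Matrix.toEuclideanCLM (𝕜 := ℂ) (X j k)‖ ^ 2 := by
    rw [norm_tupleOp_apply_sq]
    refine Finset.sum_congr rfl fun j _ => ?_
    rw [norm_blockKronecker_apply, Finset.sum_eq_single k (fun k' _ h => by simp [hxk' k' h])
      (by simp), hxk, norm_kroneckerAt_tensorVector j _ y hy, hyX]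
  rw [← hB, ← mul_one (‖tupleOp (blockKronecker X)‖ ^ 2), ← hx1, ← mul_pow]
  gcongr
  exact ContinuousLinearMap.le_opNorm _ _

theorem maximalRange_blockKronecker_subset (hp : ∀ k j, 0 < p k j) :
    maximalRange (blockKronecker X) ⊆ convexHull ℝ
      (⋃ k ∈ {k : K | ∑ j, ‖Matrix.toEuclideanCLM (𝕜 := ℂ) (X j k)‖ ^ 2 =
        ‖tupleOp (blockKronecker X)‖ ^ 2}, Set.univ.pi fun j => maximalRangeSingle (X j k)) := by
  intro z hz
  obtain ⟨x, hx, hB, hz⟩ := (mem_maximalRange_iff _ _).1 hz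
  have hN := sum_norm_sq_le_norm_tupleOp_blockKronecker X hp
  obtain ⟨N, hNdef⟩ : ∃ N, N = ‖tupleOp (blockKronecker X)‖ ^ 2 := ⟨_, rfl⟩
  rw [← hNdef] at hB hN ⊢
  have hx1 : ∑ k, ‖blockPart x k‖ ^ 2 = 1 := by rw [← norm_sq_eq_sum_blockPart, hx, one_pow]
  obtain ⟨F, hF⟩ : ∃ F : K → Fin d → ℝ, ∀ k j, F k j =
      ‖Matrix.toEuclideanCLM (𝕜 := ℂ) (kroneckerAt j (X j k)) (blockPart x k)‖ ^ 2 :=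
    ⟨_, fun _ _ => rfl⟩
  obtain ⟨G, hG⟩ : ∃ G : K → Fin d → ℝ, ∀ k j, G k j =
      ‖Matrix.toEuclideanCLM (𝕜 := ℂ) (X j k)‖ ^ 2 := ⟨_, fun _ _ => rfl⟩
  have hle : ∀ k j, F k j ≤ G k j * ‖blockPart x k‖ ^ 2 := fun k j => by
    rw [hF, hG]
    exact norm_kroneckerAt_apply_le j _ _
  have hle1 : ∀ k, ∑ j, F k j ≤ (∑ j, G k j) * ‖blockPart x k‖ ^ 2 := fun k => by
    rw [Finset.sum_mul]
    exact Finset.sum_le_sum fun j _ => hle k j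
  have hle2 : ∀ k, (∑ j, G k j) * ‖blockPart x k‖ ^ 2 ≤ N * ‖blockPart x k‖ ^ 2 := fun k => by
    simp only [hG]
    gcongr
    exact hN k
  have hsum : ∑ k, ∑ j, F k j = ∑ k, N * ‖blockPart x k‖ ^ 2 := by
    rw [← Finset.mul_sum, hx1, mul_one, ← hB, Finset.sum_comm]
    simp only [hF, norm_blockKronecker_apply]
  -- The two ends of the chain `hle1`, `hle2` have equal sums over `k`, so equality holds in each
  -- block, and then for each `j`.
  have heq : ∀ k, ∑ j, F k j = N * ‖blockPart x k‖ ^ 2 :=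
    eq_of_sum_eq_of_le _ _ (fun k => (hle1 k).trans (hle2 k)) hsum
  have hattain : ∀ k j, F k j = G k j * ‖blockPart x k‖ ^ 2 := fun k =>
    eq_of_sum_eq_of_le _ _ (hle k) (by
      rw [← Finset.sum_mul]
      exact le_antisymm (hle1 k) ((hle2 k).trans (heq k).ge))
  have hsub : ∀ {M : Type} [AddCommMonoid M] (f : K → M), (∀ k, blockPart x k = 0 → f k = 0) →
      ∑ k with blockPart x k ≠ 0, f k = ∑ k, f k := fun f hf =>
    Finset.sum_subset (Finset.subset_univ _) fun k _ hk => hf k (by simpa using hk)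
  obtain ⟨η, hη⟩ : ∃ η : ∀ k, EuclideanSpace ℂ (∀ j, Fin (p k j)),
    ∀ k, η k = ((‖blockPart x k‖⁻¹ : ℝ) : ℂ) • blockPart x k := ⟨_, fun _ => rfl⟩
  have hzsum : z = ∑ k with blockPart x k ≠ 0, ‖blockPart x k‖ ^ 2 • (fun j =>
      ⟪η k, Matrix.toEuclideanCLM (𝕜 := ℂ) (kroneckerAt j (X j k)) (η k)⟫_ℂ : Fin d → ℂ) := by
    funext j
    rw [hz, inner_blockKronecker_apply, Finset.sum_apply, ← hsub _ (fun k hk => by simp [hk])]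
    refine Finset.sum_congr rfl fun k hk => ?_
    have hk0 : blockPart x k ≠ 0 := by simpa using hk
    have h3 : ((‖blockPart x k‖ : ℝ) : ℂ) ≠ 0 := by exact_mod_cast norm_ne_zero_iff.2 hk0
    rw [Pi.smul_apply, hη, map_smul, inner_smul_left, inner_smul_right, Complex.conj_ofReal,
      Complex.real_smul]
    push_cast
    field_simp
  rw [hzsum]
  refine (convex_convexHull ℝ _).sum_mem (fun k _ => by positivity) ?_ fun k hk => ?_
  · rw [hsub _ (fun k hk => by simp [hk]), hx1]
  · have hk0 : blockPart x k ≠ 0 := by simpa using hk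
    have hk1 : ‖blockPart x k‖ ≠ 0 := norm_ne_zero_iff.2 hk0
    apply subset_convexHull
    simp only [Set.mem_iUnion, exists_prop]
    refine ⟨k, ?_, ?_⟩
    -- The block is nonzero, so `‖blockPart x k‖²` can be cancelled.
    · refine le_antisymm (hN k) ?_
      have h1 := (heq k).ge.trans (hle1 k)
      simp only [hG] at h1
      exact le_of_mul_le_mul_right h1 (by positivity)
    · intro j _
      refine inner_kroneckerAt_mem_maximalRangeSingle j _ _ ?_ ?_
      · rw [hη, norm_smul, Complex.norm_real, norm_inv, norm_norm, inv_mul_cancel₀ hk1, one_pow]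
      · rw [hη, map_smul, norm_smul, Complex.norm_real, norm_inv, norm_norm, mul_pow, ← hF, hattain, hG]
        field_simp

/-- Block `k` of the witness is `√(t k)` times a product of norming vectors, or zero when `t k = 0`.
-/
theorem convexHull_subset_maximalRange_blockKronecker :
    convexHull ℝ
      (⋃ k ∈ {k : K | ∑ j, ‖Matrix.toEuclideanCLM (𝕜 := ℂ) (X j k)‖ ^ 2 =
        ‖tupleOp (blockKronecker X)‖ ^ 2}, Set.univ.pi fun j => maximalRangeSingle (X j k)) ⊆
      maximalRange (blockKronecker X) := by
  intro z hz
  obtain ⟨t, ζ, ht0, ht1, hζ, rfl⟩ := mem_convexHull_biUnion _ _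
    (fun k => convex_pi fun j _ => convex_maximalRangeSingle (X j k)) hz
  have hblock : ∀ k, ∃ ξ : EuclideanSpace ℂ (∀ j, Fin (p k j)), ‖ξ‖ ^ 2 = t k ∧
      (∑ j, ‖Matrix.toEuclideanCLM (𝕜 := ℂ) (kroneckerAt j (X j k)) ξ‖ ^ 2 =
        t k * ‖tupleOp (blockKronecker X)‖ ^ 2) ∧
      ∀ j, ⟪ξ, Matrix.toEuclideanCLM (𝕜 := ℂ) (kroneckerAt j (X j k)) ξ⟫_ℂ = t k * ζ k j := by
    intro k
    by_cases hk : t k = 0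
    · exact ⟨0, by simp [hk]⟩
    · obtain ⟨hS, hζk⟩ := hζ k hk
      have hV : ∀ j, ζ k j ∈ maximalRangeSingle (X j k) := fun j => hζk j (Set.mem_univ j)
      simp only [mem_maximalRangeSingle_iff] at hV
      choose y hy hyX hyζ using hV
      have hsq : √(t k) ^ 2 = t k := Real.sq_sqrt (ht0 k)
      refine ⟨((√(t k) : ℝ) : ℂ) • tensorVector y, ?_, ?_, fun j => ?_⟩
      · rw [norm_smul, mul_pow, Complex.norm_real, Real.norm_eq_abs, sq_abs, hsq,
          norm_tensorVector]
        simp [hy]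
      · simp only [map_smul, norm_smul, mul_pow, Complex.norm_real, Real.norm_eq_abs, sq_abs, hsq]
        rw [← Finset.mul_sum, ← hS]
        congr 1
        exact Finset.sum_congr rfl fun j _ => by
          rw [norm_kroneckerAt_tensorVector j _ y hy, hyX]
      · rw [map_smul, inner_smul_left, inner_smul_right, Complex.conj_ofReal,
          inner_kroneckerAt_tensorVector j _ y hy, hyζ, ← mul_assoc, ← Complex.ofReal_mul,
          ← sq, hsq]
  choose ξ hξ hξN hξz using hblock
  obtain ⟨x, hx⟩ : ∃ x : EuclideanSpace ℂ (Σ k, ∀ j, Fin (p k j)), ∀ k, blockPart x k = ξ k :=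
    ⟨WithLp.toLp 2 fun s => ξ s.1 s.2, fun _ => rfl⟩
  refine (mem_maximalRange_iff _ _).2 ⟨x, ?_, ?_, fun j => ?_⟩
  · have : ‖x‖ ^ 2 = 1 := by
      rw [norm_sq_eq_sum_blockPart, ← ht1]
      exact Finset.sum_congr rfl fun k _ => by rw [hx, hξ]
    exact (pow_eq_one_iff_of_nonneg (norm_nonneg x) two_ne_zero).1 this
  · simp only [norm_blockKronecker_apply, hx]
    rw [Finset.sum_comm]
    simp only [hξN]
    rw [← Finset.sum_mul, ht1, one_mul]
  · rw [inner_blockKronecker_apply, Finset.sum_apply]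
    exact Finset.sum_congr rfl fun k _ => by
      rw [hx, hξz, Pi.smul_apply, Complex.real_smul]

end BlockKronecker

/-! ### Transport along the unitary of a decomposition -/

theorem BRDecomposition.exists_intertwining {n d : ℕ} {A : Fin d → Matrix (Fin n) (Fin n) ℂ}
    (D : BRDecomposition A) :
    ∃ u : EuclideanSpace ℂ (Σ k : Fin D.l, ∀ j : Fin d, Fin (D.p k j)) ≃ₗᵢ[ℂ]
        EuclideanSpace ℂ (Fin n),
      ∀ j x, Matrix.toEuclideanCLM (𝕜 := ℂ) (A j) (u x) =
        u (Matrix.toEuclideanCLM (𝕜 := ℂ) (blockKronecker D.X j) x) := by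
  obtain ⟨W, hW⟩ : ∃ W : EuclideanSpace ℂ (Fin n) ≃ₗᵢ[ℂ] EuclideanSpace ℂ (Fin n),
      ∀ x, W x = Matrix.toEuclideanCLM (𝕜 := ℂ) D.U.conjTranspose x := by
    have hU : D.U * D.U.conjTranspose = 1 := Matrix.mem_unitaryGroup_iff.1 D.U_unitary
    have hU' : D.U.conjTranspose * D.U = 1 := Matrix.mem_unitaryGroup_iff'.1 D.U_unitary
    refine ⟨⟨LinearEquiv.ofLinearMap (Matrix.toEuclideanCLM (𝕜 := ℂ) D.U.conjTranspose).toLinearMap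
      (Matrix.toEuclideanCLM (𝕜 := ℂ) D.U).toLinearMap ?_ ?_, fun x => ?_⟩, fun x => rfl⟩
    · ext1 x
      change (Matrix.toEuclideanCLM (𝕜 := ℂ) D.U.conjTranspose *
        Matrix.toEuclideanCLM (𝕜 := ℂ) D.U) x = x
      rw [← map_mul, hU', map_one]
      rfl
    · ext1 x
      change (Matrix.toEuclideanCLM (𝕜 := ℂ) D.U *
        Matrix.toEuclideanCLM (𝕜 := ℂ) D.U.conjTranspose) x = x
      rw [← map_mul, hU, map_one]
      rfl
    · change ‖Matrix.toEuclideanCLM (𝕜 := ℂ) D.U.conjTranspose x‖ = ‖x‖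
      rw [← sq_eq_sq₀ (norm_nonneg _) (norm_nonneg _)]
      have h : Matrix.toEuclideanCLM (𝕜 := ℂ) D.U.conjTranspose =
          ContinuousLinearMap.adjoint (Matrix.toEuclideanCLM (𝕜 := ℂ) D.U) :=
        map_star (Matrix.toEuclideanCLM (𝕜 := ℂ)) D.U
      have h2 : ⟪Matrix.toEuclideanCLM (𝕜 := ℂ) D.U.conjTranspose x,
          Matrix.toEuclideanCLM (𝕜 := ℂ) D.U.conjTranspose x⟫_ℂ = ⟪x, x⟫_ℂ := by
        conv_lhs => rw [h, ContinuousLinearMap.adjoint_inner_left, ← h]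
        congr 1
        change (Matrix.toEuclideanCLM (𝕜 := ℂ) D.U *
          Matrix.toEuclideanCLM (𝕜 := ℂ) D.U.conjTranspose) x = x
        rw [← map_mul, hU, map_one]
        rfl
      rw [inner_self_eq_ofReal, inner_self_eq_ofReal] at h2
      exact_mod_cast h2
  -- The isometry is `U*` after renumbering coordinates by `e`.
  refine ⟨(LinearIsometryEquiv.piLpCongrLeft 2 ℂ ℂ D.e.symm).trans W, fun j x => ?_⟩
  have hA : A j * D.U.conjTranspose = D.U.conjTranspose *
      Matrix.reindex D.e.symm D.e.symm (blockKronecker D.X j) := by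
    have h := D.eq_blockDiagonal j
    have hU' : D.U.conjTranspose * D.U = 1 := Matrix.mem_unitaryGroup_iff'.1 D.U_unitary
    have h2 : D.U * A j * D.U.conjTranspose =
        Matrix.reindex D.e.symm D.e.symm (blockKronecker D.X j) := by
      rw [blockKronecker, ← h]
      ext
      simp
    rw [← h2, ← Matrix.mul_assoc, ← Matrix.mul_assoc, hU', Matrix.one_mul]
  simp only [LinearIsometryEquiv.trans_apply, hW]
  obtain ⟨y, hy⟩ : ∃ y, y = (LinearIsometryEquiv.piLpCongrLeft 2 ℂ ℂ D.e.symm) x := ⟨_, rfl⟩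
  rw [← hy]
  have h3 := congrArg (fun M => Matrix.toEuclideanCLM (𝕜 := ℂ) M y) hA
  simp only [map_mul] at h3
  refine h3.trans ?_
  change Matrix.toEuclideanCLM (𝕜 := ℂ) D.U.conjTranspose _ = _
  congr 1
  ext i
  rw [hy]
  simp only [Matrix.ofLp_toEuclideanCLM, Matrix.mulVec, dotProduct, Matrix.reindex_apply,
    LinearIsometryEquiv.piLpCongrLeft_apply, Equiv.piCongrLeft'_apply,
    Equiv.symm_symm]
  exact D.e.sum_comp fun s => blockKronecker D.X j (D.e i) s * x s

theorem BRDecomposition.maximalRange_eq {n d : ℕ} {A : Fin d → Matrix (Fin n) (Fin n) ℂ}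
    (D : BRDecomposition A) :
    maximalRange A =
      convexHull ℝ
        (⋃ k ∈ {k : Fin D.l |
            ∑ j, ‖Matrix.toEuclideanCLM (𝕜 := ℂ) (D.X j k)‖ ^ 2 = ‖tupleOp A‖ ^ 2},
          Set.univ.pi fun j => maximalRangeSingle (D.X j k)) := by
  obtain ⟨u, hu⟩ := D.exists_intertwining
  obtain ⟨h1, h2⟩ := maximalRange_eq_of_intertwining A _ u hu
  rw [h1, h2]
  exact (maximalRange_blockKronecker_subset D.X D.p_pos).antisymm
    (convexHull_subset_maximalRange_blockKronecker D.X)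

/-! ### Reducing subspaces and Schur's lemma -/

section Reducing

theorem mem_of_commute_starProjection {H : Type*} [NormedAddCommGroup H] [InnerProductSpace ℂ H]
    {V : Submodule ℂ H} [V.HasOrthogonalProjection]
    {T : H →L[ℂ] H} (h : V.starProjection * T = T * V.starProjection) {x : H} (hx : x ∈ V) :
    T x ∈ V := by
  have h1 : V.starProjection (T x) = T (V.starProjection x) := congrArg (fun S => S x) h
  rw [Submodule.starProjection_eq_self_iff.2 hx] at h1
  exact Submodule.starProjection_eq_self_iff.1 h1

variable {H : Type*} [NormedAddCommGroup H] [InnerProductSpace ℂ H] [CompleteSpace H]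

/-- The subspace `V` reduces the operator `T`: it is invariant under `T` and its adjoint. -/
def IsReducing (V : Submodule ℂ H) (T : H →L[ℂ] H) : Prop :=
  (∀ x ∈ V, T x ∈ V) ∧ ∀ x ∈ V, star T x ∈ V

theorem star_inner_left (T : H →L[ℂ] H) (x y : H) : ⟪star T x, y⟫_ℂ = ⟪x, T y⟫_ℂ :=
  ContinuousLinearMap.adjoint_inner_left T y x

theorem star_inner_right (T : H →L[ℂ] H) (x y : H) : ⟪x, star T y⟫_ℂ = ⟪T x, y⟫_ℂ :=
  ContinuousLinearMap.adjoint_inner_right T x y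

theorem IsReducing.star {V : Submodule ℂ H} {T : H →L[ℂ] H} (h : IsReducing V T) :
    IsReducing V (star T) :=
  ⟨h.2, by rw [star_star]; exact h.1⟩

theorem IsReducing.inf {V W : Submodule ℂ H} {T : H →L[ℂ] H} (hV : IsReducing V T)
    (hW : IsReducing W T) : IsReducing (V ⊓ W) T :=
  ⟨fun x hx => ⟨hV.1 x hx.1, hW.1 x hx.2⟩, fun x hx => ⟨hV.2 x hx.1, hW.2 x hx.2⟩⟩

theorem IsReducing.orthogonal {V : Submodule ℂ H} {T : H →L[ℂ] H} (h : IsReducing V T) :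
    IsReducing Vᗮ T := by
  constructor
  · intro x hx
    rw [Submodule.mem_orthogonal] at hx ⊢
    intro u hu
    rw [← star_inner_left]
    exact hx _ (h.2 u hu)
  · intro x hx
    rw [Submodule.mem_orthogonal] at hx ⊢
    intro u hu
    rw [star_inner_right]
    exact hx _ (h.1 u hu)

theorem IsReducing.commute_starProjection {V : Submodule ℂ H} [V.HasOrthogonalProjection]
    {T : H →L[ℂ] H} (h : IsReducing V T) : Commute V.starProjection T := by
  ext x
  change V.starProjection (T x) = T (V.starProjection x)
  have hx : x = V.starProjection x + Vᗮ.starProjection x :=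
    (Submodule.starProjection_add_starProjection_orthogonal x).symm
  conv_lhs => rw [hx, map_add, map_add]
  rw [Submodule.starProjection_eq_self_iff.2 (h.1 _ (V.starProjection_apply_mem x)),
    (V.starProjection_apply_eq_zero_iff).2
      (h.orthogonal.1 _ (Vᗮ.starProjection_apply_mem x)), add_zero]

variable [FiniteDimensional ℂ H]

/-- **Schur's lemma** for a minimal reducing subspace of an operator. -/
theorem exists_inner_eq_mul_of_minimal {W : Submodule ℂ H} {T R : H →L[ℂ] H} (hW0 : W ≠ ⊥)
    (hWT : IsReducing W T)
    (hmin : ∀ W' : Submodule ℂ H, W' ≤ W → W' ≠ ⊥ → IsReducing W' T → W' = W)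
    (hR : T * R = R * T) (hR' : star T * R = R * star T) :
    ∃ c : ℂ, ∀ w ∈ W, ∀ w' ∈ W, ⟪w, R w'⟫_ℂ = c * ⟪w, w'⟫_ℂ := by
  have : Nontrivial W := Submodule.nontrivial_iff_ne_bot.2 hW0
  have hP := hWT.commute_starProjection
  have hP' := hWT.star.commute_starProjection
  -- The compression of `R` to `W` commutes with `T` and `star T`, so its eigenspace in `W` is
  -- reducing, and by minimality is all of `W`.
  obtain ⟨Q, hQ⟩ : ∃ Q : H →L[ℂ] H, Q = W.starProjection * R := ⟨_, rfl⟩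
  have hQW : ∀ x, Q x ∈ W := fun x => by rw [hQ]; exact W.starProjection_apply_mem _
  have hQT : ∀ x, Q (T x) = T (Q x) := fun x => by
    have : Q * T = T * Q := by rw [hQ, mul_assoc, ← hR, ← mul_assoc, hP.eq, mul_assoc]
    exact congrArg (fun S => S x) this
  have hQT' : ∀ x, Q (star T x) = star T (Q x) := fun x => by
    have : Q * star T = star T * Q := by
      rw [hQ, mul_assoc, ← hR', ← mul_assoc, hP'.eq, mul_assoc]
    exact congrArg (fun S => S x) this
  obtain ⟨c, hc⟩ := Module.End.exists_eigenvalue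
    (Q.toLinearMap.restrict (p := W) (q := W) fun x _ => hQW x)
  obtain ⟨w, hw⟩ := hc.exists_hasEigenvector
  have hwc : Q w = c • (w : H) := congrArg Subtype.val hw.apply_eq_smul
  have hw0 : (w : H) ≠ 0 := fun h => hw.2 (Subtype.ext h)
  have hker : ∀ x, x ∈ LinearMap.ker (Q.toLinearMap - c • LinearMap.id) ↔ Q x = c • x :=
    fun x => by
      rw [LinearMap.mem_ker]
      exact sub_eq_zero
  have hW' := hmin (W ⊓ LinearMap.ker (Q.toLinearMap - c • LinearMap.id)) inf_le_left
    (fun h => hw0 ((Submodule.eq_bot_iff _).1 h w ⟨w.2, (hker w).2 hwc⟩))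
    (hWT.inf ⟨fun x hx => by
      rw [hker] at hx ⊢
      rw [hQT, hx, map_smul], fun x hx => by
      rw [hker] at hx ⊢
      rw [hQT', hx, map_smul]⟩)
  refine ⟨c, fun w hw w' hw' => ?_⟩
  have h1 : Q w' = c • w' := by
    rw [← hW'] at hw'
    exact (hker w').1 hw'.2
  have h2 : ⟪w, Q w'⟫_ℂ = ⟪w, R w'⟫_ℂ := by
    rw [hQ]
    change ⟪w, W.starProjection (R w')⟫_ℂ = _
    rw [← Submodule.inner_starProjection_left_eq_right, Submodule.starProjection_eq_self_iff.2 hw]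
  rw [← h2, h1, inner_smul_right]

theorem exists_minimal_isReducing {V : Submodule ℂ H} {T : H →L[ℂ] H} (hV0 : V ≠ ⊥)
    (hV : IsReducing V T) :
    ∃ W ≤ V, W ≠ ⊥ ∧ IsReducing W T ∧
      ∀ W' : Submodule ℂ H, W' ≤ W → W' ≠ ⊥ → IsReducing W' T → W' = W := by
  obtain ⟨W, hW⟩ := exists_minimal_of_wellFoundedLT
    (fun W : Submodule ℂ H => W ≤ V ∧ W ≠ ⊥ ∧ IsReducing W T) ⟨V, le_rfl, hV0, hV⟩
  exact ⟨W, hW.prop.1, hW.prop.2.1, hW.prop.2.2, fun W' h1 h2 h3 =>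
    hW.eq_of_le ⟨h1.trans hW.prop.1, h2, h3⟩ h1⟩

end Reducing

/-! ### Orthonormal bases made of tensor blocks -/

section TensorBlock

variable {H : Type*} [NormedAddCommGroup H] [InnerProductSpace ℂ H]

/-- A family `v` of vectors indexed by multi-indices, on which the operators `A j` act like
`I ⊗ ⋯ ⊗ X j ⊗ ⋯ ⊗ I` on the standard basis of a tensor product. -/
structure TensorBlock {d : ℕ} (A : Fin d → H →L[ℂ] H) where
  p : Fin d → ℕ
  p_pos : ∀ j, 0 < p j
  X : ∀ j, Matrix (Fin (p j)) (Fin (p j)) ℂ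
  v : (∀ j, Fin (p j)) → H
  act : ∀ j a, A j (v a) = ∑ c, X j c (a j) • v (Function.update a j c)

/-- All the vectors of a family of blocks. -/
def blockVectors {d : ℕ} {A : Fin d → H →L[ℂ] H} {K : Type} (D : K → TensorBlock A)
    (s : Σ k, ∀ j, Fin ((D k).p j)) : H :=
  (D s.1).v s.2

/-- The subspace `V` has an orthonormal basis made of blocks. -/
def HasTensorBlocks {d : ℕ} (A : Fin d → H →L[ℂ] H) (V : Submodule ℂ H) : Prop :=
  ∃ (K : Type) (_ : Fintype K) (D : K → TensorBlock A),
    Orthonormal ℂ (blockVectors D) ∧ Submodule.span ℂ (Set.range (blockVectors D)) = V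

theorem hasTensorBlocks_bot {d : ℕ} (A : Fin d → H →L[ℂ] H) : HasTensorBlocks A ⊥ := by
  refine ⟨Empty, inferInstance, Empty.elim, ⟨fun s => s.1.elim, fun s => s.1.elim⟩, ?_⟩
  have : IsEmpty (Σ k : Empty, ∀ j, Fin ((Empty.elim k : TensorBlock A).p j)) :=
    ⟨fun s => s.1.elim⟩
  rw [Set.range_eq_empty, Submodule.span_empty]

theorem HasTensorBlocks.sup {d : ℕ} {A : Fin d → H →L[ℂ] H} {V W : Submodule ℂ H}
    (hV : HasTensorBlocks A V) (hW : HasTensorBlocks A W) (hVW : W ≤ Vᗮ) :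
    HasTensorBlocks A (V ⊔ W) := by
  obtain ⟨K, _, D, hD, rfl⟩ := hV
  obtain ⟨L, _, E, hE, rfl⟩ := hW
  have hDE : ∀ s t, ⟪blockVectors D s, blockVectors E t⟫_ℂ = 0 := fun s t =>
    Submodule.mem_orthogonal _ _ |>.1 (hVW (Submodule.subset_span ⟨t, rfl⟩)) _
      (Submodule.subset_span ⟨s, rfl⟩)
  refine ⟨K ⊕ L, inferInstance, Sum.elim D E, ⟨?_, ?_⟩, ?_⟩
  · rintro ⟨k | k, a⟩
    · exact hD.1 ⟨k, a⟩
    · exact hE.1 ⟨k, a⟩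
  · rintro ⟨k | k, a⟩ ⟨l | l, b⟩ hne
    · exact hD.2 (i := ⟨k, a⟩) (j := ⟨l, b⟩) fun h => hne (by cases h; rfl)
    · exact hDE ⟨k, a⟩ ⟨l, b⟩
    · exact inner_eq_zero_symm.1 (hDE ⟨l, b⟩ ⟨k, a⟩)
    · exact hE.2 (i := ⟨k, a⟩) (j := ⟨l, b⟩) fun h => hne (by cases h; rfl)
  · rw [← Submodule.span_union]
    congr 1
    ext x
    constructor
    · rintro ⟨⟨k | k, a⟩, rfl⟩
      · exact Or.inl ⟨⟨k, a⟩, rfl⟩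
      · exact Or.inr ⟨⟨k, a⟩, rfl⟩
    · rintro (⟨⟨k, a⟩, rfl⟩ | ⟨⟨k, a⟩, rfl⟩)
      · exact ⟨⟨Sum.inl k, a⟩, rfl⟩
      · exact ⟨⟨Sum.inr k, a⟩, rfl⟩

theorem exists_orthonormal_fin_span_eq [FiniteDimensional ℂ H] (V : Submodule ℂ H) :
    ∃ e : Fin (Module.finrank ℂ V) → H, Orthonormal ℂ e ∧
      Submodule.span ℂ (Set.range e) = V := by
  obtain ⟨b⟩ : Nonempty (OrthonormalBasis (Fin (Module.finrank ℂ V)) ℂ V) :=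
    ⟨stdOrthonormalBasis ℂ V⟩
  refine ⟨fun i => b i, b.orthonormal.comp_linearIsometry V.subtypeₗᵢ, ?_⟩
  have h : Set.range (fun i => (b i : H)) = V.subtype '' Set.range b := by
    rw [← Set.range_comp]
    rfl
  have hb : Submodule.span ℂ (Set.range b) = ⊤ := by
    rw [← b.coe_toBasis]
    exact b.toBasis.span_eq
  rw [h, ← Submodule.map_span, hb, Submodule.map_subtype_top]

theorem Orthonormal.sum_inner_smul_of_mem_span {ι : Type*} [Fintype ι] {e : ι → H}
    (he : Orthonormal ℂ e) {x : H} (hx : x ∈ Submodule.span ℂ (Set.range e)) :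
    x = ∑ i, ⟪e i, x⟫_ℂ • e i := by
  obtain ⟨c, rfl⟩ := (Submodule.mem_span_range_iff_exists_fun ℂ).1 hx
  exact Finset.sum_congr rfl fun i _ => by rw [he.inner_right_fintype]

/-- An empty tensor product is one-dimensional, so each vector of an orthonormal basis is a block.
-/
theorem hasTensorBlocks_zero [FiniteDimensional ℂ H] (A : Fin 0 → H →L[ℂ] H)
    (V : Submodule ℂ H) : HasTensorBlocks A V := by
  obtain ⟨e, he, hspan⟩ := exists_orthonormal_fin_span_eq V
  refine ⟨Fin (Module.finrank ℂ V), inferInstance, fun k =>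
    ⟨fun _ => 0, fun j => j.elim0, fun j => j.elim0, fun _ => e k, fun j => j.elim0⟩, ?_, ?_⟩
  · refine he.comp (fun s : Σ _ : Fin (Module.finrank ℂ V), ∀ j : Fin 0, Fin 0 => s.1) ?_
    rintro ⟨k, a⟩ ⟨l, b⟩ h
    cases h
    congr 1
    exact Subsingleton.elim _ _
  · refine Eq.trans (congrArg _ ?_) hspan
    ext x
    exact ⟨fun ⟨s, hs⟩ => ⟨s.1, hs⟩, fun ⟨k, hk⟩ => ⟨⟨k, fun j => j.elim0⟩, hk⟩⟩

end TensorBlock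

/-! ### Existence of tensor blocks -/

section Existence

variable {H : Type*} [NormedAddCommGroup H] [InnerProductSpace ℂ H]

/-- Adjoin a first tensor factor to a block. -/
def TensorBlock.cons {d : ℕ} {A : Fin (d + 1) → H →L[ℂ] H}
    (B : TensorBlock fun j : Fin d => A j.succ) {q : ℕ} (hq : 0 < q)
    (X : Matrix (Fin q) (Fin q) ℂ) (u : Fin q → (∀ j, Fin (B.p j)) → H)
    (h_zero : ∀ i a, A 0 (u i a) = ∑ c, X c i • u c a)
    (h_succ : ∀ j i a, A j.succ (u i a) = ∑ c, B.X j c (a j) • u i (Function.update a j c)) :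
    TensorBlock A where
  p := Fin.cons q B.p
  p_pos := Fin.cases hq B.p_pos
  X := Fin.cases (motive := fun j => Matrix (Fin ((Fin.cons q B.p : Fin (d + 1) → ℕ) j))
    (Fin ((Fin.cons q B.p : Fin (d + 1) → ℕ) j)) ℂ) X B.X
  v a := u (a 0) (Fin.tail a)
  act := by
    intro j
    refine Fin.cases ?_ (fun j => ?_) j
    · intro a
      refine (h_zero _ _).trans (Finset.sum_congr rfl fun c _ => ?_)
      exact (congrArg₂ (fun i b => X c (a 0) • u i b)
        (Function.update_self (β := fun j => Fin ((Fin.cons q B.p : Fin (d + 1) → ℕ) j)) 0 c a)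
        (Fin.tail_update_zero
          (α := fun j => Fin ((Fin.cons q B.p : Fin (d + 1) → ℕ) j)) a c)).symm
    · intro a
      refine (h_succ _ _ _).trans (Finset.sum_congr rfl fun c _ => ?_)
      exact (congrArg₂ (fun i b => B.X j c (Fin.tail a j) • u i b)
        (Function.update_of_ne (β := fun j => Fin ((Fin.cons q B.p : Fin (d + 1) → ℕ) j))
          (Fin.succ_ne_zero j).symm c a)
        (Fin.tail_update_succ
          (α := fun j => Fin ((Fin.cons q B.p : Fin (d + 1) → ℕ) j)) a j c)).symm

variable [CompleteSpace H] [FiniteDimensional ℂ H]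

theorem exists_reducing_hasTensorBlocks {d : ℕ} (A : Fin (d + 1) → H →L[ℂ] H)
    (hA : ∀ i j, i ≠ j → A i * A j = A j * A i ∧ star (A i) * A j = A j * star (A i))
    (ih : ∀ N : Submodule ℂ H, (∀ j : Fin d, IsReducing N (A j.succ)) →
      HasTensorBlocks (fun j : Fin d => A j.succ) N)
    (V : Submodule ℂ H) (hV : ∀ j, IsReducing V (A j)) (hV0 : V ≠ ⊥) :
    ∃ V₁ ≤ V, V₁ ≠ ⊥ ∧ (∀ j, IsReducing V₁ (A j)) ∧ HasTensorBlocks A V₁ := by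
  obtain ⟨W, hWV, hW0, hW, hmin⟩ := exists_minimal_isReducing hV0 (hV 0)
  -- Commuting with the projection onto `V` keeps the vectors `T w` inside `V`.
  obtain ⟨C, hC⟩ : ∃ C : StarSubalgebra ℂ (H →L[ℂ] H),
      C = StarSubalgebra.centralizer ℂ {A 0, V.starProjection} := ⟨_, rfl⟩
  have hC0 : ∀ T ∈ C, A 0 * T = T * A 0 ∧ star (A 0) * T = T * star (A 0) := fun T hT => by
    rw [hC, StarSubalgebra.mem_centralizer_iff] at hT
    exact hT _ (by simp)
  have hCV : ∀ T ∈ C, ∀ x ∈ V, T x ∈ V := fun T hT x hx => by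
    rw [hC, StarSubalgebra.mem_centralizer_iff] at hT
    exact mem_of_commute_starProjection (hT V.starProjection (by simp)).1 hx
  have hAC : ∀ j : Fin d, A j.succ ∈ C := fun j => by
    rw [hC, StarSubalgebra.mem_centralizer_iff]
    have hsa : star V.starProjection = V.starProjection :=
      (isSelfAdjoint_starProjection V).star_eq
    rintro g (rfl | rfl)
    · exact hA 0 j.succ (Fin.succ_ne_zero j).symm
    · rw [hsa, and_self]
      exact (hV j.succ).commute_starProjection.eq
  obtain ⟨w₀, hw₀W, hw₀⟩ : ∃ w₀ ∈ W, ‖w₀‖ = 1 := by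
    obtain ⟨w, hw, hne⟩ := Submodule.exists_mem_ne_zero_of_ne_bot hW0
    exact ⟨((‖w‖⁻¹ : ℝ) : ℂ) • w, W.smul_mem _ hw, by
      rw [norm_smul, Complex.norm_real, norm_inv, norm_norm,
        inv_mul_cancel₀ (norm_ne_zero_iff.2 hne)]⟩
  have hw₀1 : ⟪w₀, w₀⟫_ℂ = 1 := by rw [inner_self_eq_ofReal, hw₀]; norm_num
  -- Schur's lemma for `star T * S`; its scalar is read off at `w₀`.
  have schur : ∀ T ∈ C, ∀ S ∈ C, ∀ w ∈ W, ∀ w' ∈ W,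
      ⟪T w, S w'⟫_ℂ = ⟪T w₀, S w₀⟫_ℂ * ⟪w, w'⟫_ℂ := by
    intro T hT S hS w hw w' hw'
    have hTS : star T * S ∈ C := mul_mem (star_mem hT) hS
    obtain ⟨c, hc⟩ := exists_inner_eq_mul_of_minimal hW0 hW hmin (hC0 _ hTS).1 (hC0 _ hTS).2
    have hc' : ∀ w ∈ W, ∀ w' ∈ W, ⟪T w, S w'⟫_ℂ = c * ⟪w, w'⟫_ℂ := fun w hw w' hw' => by
      rw [← hc w hw w' hw', ← star_inner_right]
      rfl
    rw [hc' w hw w' hw', hc' w₀ hw₀W w₀ hw₀W, hw₀1, mul_one]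
  -- An element of `C` is thus determined on `W` by its value at `w₀`; linear relations in `C w₀`
  -- lift to all of `W`.
  have hvanish : ∀ T ∈ C, T w₀ = 0 → ∀ w ∈ W, T w = 0 := fun T hT h w hw => by
    rw [← inner_self_eq_zero (𝕜 := ℂ), schur T hT T hT w hw w hw, h, inner_zero_left, zero_mul]
  obtain ⟨N, hN⟩ : ∃ N : Submodule ℂ H, ∀ x, x ∈ N ↔ ∃ T ∈ C, T w₀ = x :=
    ⟨C.toSubalgebra.toSubmodule.map
      (ContinuousLinearMap.apply ℂ H w₀ : (H →L[ℂ] H) →L[ℂ] H).toLinearMap, fun x => Iff.rfl⟩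
  obtain ⟨K, _, D, hD, hDspan⟩ := ih N fun j => by
    constructor
    · intro x hx
      obtain ⟨T, hT, rfl⟩ := (hN x).1 hx
      exact (hN _).2 ⟨_, mul_mem (hAC j) hT, rfl⟩
    · intro x hx
      obtain ⟨T, hT, rfl⟩ := (hN x).1 hx
      exact (hN _).2 ⟨_, mul_mem (star_mem (hAC j)) hT, rfl⟩
  have hlift : ∀ s, ∃ T ∈ C, T w₀ = blockVectors D s := fun s => by
    rw [← hN, ← hDspan]
    exact Submodule.subset_span ⟨s, rfl⟩
  choose T hTC hT using hlift
  obtain ⟨e, he, hespan⟩ := exists_orthonormal_fin_span_eq W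
  have heW : ∀ i, e i ∈ W := fun i => by
    have : e i ∈ Submodule.span ℂ (Set.range e) := Submodule.subset_span ⟨i, rfl⟩
    rwa [hespan] at this
  have hq : 0 < Module.finrank ℂ W := Nat.pos_of_ne_zero fun h =>
    hW0 (Submodule.finrank_eq_zero.1 h)
  -- The image of the product basis of `N ⊗ W`, where `N = C w₀`.
  obtain ⟨g, hg⟩ : ∃ g : (Σ k, ∀ j, Fin ((D k).p j)) × Fin (Module.finrank ℂ W) → H,
    ∀ x, g x = T x.1 (e x.2) := ⟨_, fun _ => rfl⟩
  have hgo : Orthonormal ℂ g := by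
    classical
    rw [orthonormal_iff_ite]
    rintro ⟨s, i⟩ ⟨t, j⟩
    rw [hg, hg, schur _ (hTC s) _ (hTC t) _ (heW i) _ (heW j), hT, hT,
      orthonormal_iff_ite.1 hD s t, orthonormal_iff_ite.1 he i j, ite_mul, one_mul, zero_mul,
      ← ite_and]
    simp only [Prod.mk.injEq]
  have hTspan : ∀ s, ∀ w ∈ W, T s w ∈ Submodule.span ℂ (Set.range g) := fun s w hw => by
    rw [he.sum_inner_smul_of_mem_span (x := w) (by rwa [hespan]), map_sum]
    refine Submodule.sum_mem _ fun i _ => ?_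
    rw [map_smul]
    exact Submodule.smul_mem _ _ (Submodule.subset_span ⟨(s, i), hg _⟩)
  have hCspan : ∀ S ∈ C, ∀ w ∈ W, S w ∈ Submodule.span ℂ (Set.range g) := by
    intro S hS w hw
    have hSN : S w₀ ∈ Submodule.span ℂ (Set.range (blockVectors D)) := by
      rw [hDspan]
      exact (hN _).2 ⟨S, hS, rfl⟩
    obtain ⟨c, hc⟩ := (Submodule.mem_span_range_iff_exists_fun ℂ).1 hSN
    have hz := hvanish (S - ∑ s, c s • T s)
      (sub_mem hS (sum_mem fun s _ => SMulMemClass.smul_mem _ (hTC s))) (by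
        simp [hT, hc]) w hw
    have hSw : S w = ∑ s, c s • T s w := by
      simpa [sum_apply, sub_eq_zero] using hz
    rw [hSw]
    exact Submodule.sum_mem _ fun s _ => Submodule.smul_mem _ _ (hTspan s w hw)
  have hinv : ∀ S : H →L[ℂ] H, (∀ x, S (g x) ∈ Submodule.span ℂ (Set.range g)) →
      ∀ x ∈ Submodule.span ℂ (Set.range g), S x ∈ Submodule.span ℂ (Set.range g) := by
    intro S hS x hx
    have : Submodule.span ℂ (Set.range g) ≤
        (Submodule.span ℂ (Set.range g)).comap S.toLinearMap := by
      rw [Submodule.span_le]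
      rintro _ ⟨y, rfl⟩
      exact hS y
    exact this hx
  refine ⟨Submodule.span ℂ (Set.range g), ?_, ?_, ?_, ?_⟩
  · rw [Submodule.span_le]
    rintro _ ⟨x, rfl⟩
    rw [hg]
    exact hCV _ (hTC _) _ (hWV (heW _))
  · intro h
    have h1 := hCspan 1 (one_mem C) w₀ hw₀W
    rw [h, Submodule.mem_bot] at h1
    rw [show w₀ = 0 from h1, norm_zero] at hw₀
    exact zero_ne_one hw₀
  · refine Fin.cases ⟨hinv _ fun x => ?_, hinv _ fun x => ?_⟩ fun j =>
      ⟨hinv _ fun x => ?_, hinv _ fun x => ?_⟩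
    · rw [hg]
      have h1 : A 0 (T x.1 (e x.2)) = T x.1 (A 0 (e x.2)) :=
        congrArg (fun S => S (e x.2)) (hC0 _ (hTC x.1)).1
      rw [h1]
      exact hTspan _ _ (hW.1 _ (heW _))
    · rw [hg]
      have h1 : star (A 0) (T x.1 (e x.2)) = T x.1 (star (A 0) (e x.2)) :=
        congrArg (fun S => S (e x.2)) (hC0 _ (hTC x.1)).2
      rw [h1]
      exact hTspan _ _ (hW.2 _ (heW _))
    · rw [hg]
      exact hCspan _ (mul_mem (hAC j) (hTC x.1)) _ (heW _)
    · rw [hg]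
      exact hCspan _ (mul_mem (star_mem (hAC j)) (hTC x.1)) _ (heW _)
  · have hzero : ∀ k i a, A 0 (T ⟨k, a⟩ (e i)) =
        ∑ c, Matrix.of (fun c i => ⟪e c, A 0 (e i)⟫_ℂ) c i • T ⟨k, a⟩ (e c) := fun k i a => by
      have h1 : A 0 (T ⟨k, a⟩ (e i)) = T ⟨k, a⟩ (A 0 (e i)) :=
        congrArg (fun S => S (e i)) (hC0 _ (hTC ⟨k, a⟩)).1
      have h2 := he.sum_inner_smul_of_mem_span (x := A 0 (e i))
        (by rw [hespan]; exact hW.1 _ (heW i))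
      rw [h1]
      conv_lhs => rw [h2]
      simp only [map_sum, map_smul, Matrix.of_apply]
    -- At `w₀` this is the block relation in `N`; `hvanish` carries it to `e i`.
    have hsucc : ∀ k j i a, A j.succ (T ⟨k, a⟩ (e i)) =
        ∑ c, (D k).X j c (a j) • T ⟨k, Function.update a j c⟩ (e i) := fun k j i a => by
      have hz := hvanish
        (A j.succ * T ⟨k, a⟩ - ∑ c, (D k).X j c (a j) • T ⟨k, Function.update a j c⟩)
        (sub_mem (mul_mem (hAC j) (hTC _))
          (sum_mem fun c _ => SMulMemClass.smul_mem _ (hTC _))) (by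
          have h1 := (D k).act j a
          simp only [sub_apply, sum_apply, smul_apply,
            mul_apply_eq_comp, hT]
          rw [sub_eq_zero]
          exact h1) (e i) (heW i)
      simpa [sum_apply, sub_eq_zero] using hz
    obtain ⟨E, hE⟩ : ∃ E : K → TensorBlock A, E = fun k =>
      (D k).cons hq _ (fun i a => T ⟨k, a⟩ (e i)) (hzero k) (hsucc k) := ⟨_, rfl⟩
    obtain ⟨φ, hφ, hφg⟩ : ∃ φ : (Σ k, ∀ j, Fin ((E k).p j)) →
        (Σ k, ∀ j, Fin ((D k).p j)) × Fin (Module.finrank ℂ W),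
        Function.Bijective φ ∧ blockVectors E = g ∘ φ := by
      subst hE
      refine ⟨fun s => (⟨s.1, Fin.tail s.2⟩, s.2 0), ⟨?_, ?_⟩, ?_⟩
      · rintro ⟨k, a⟩ ⟨l, b⟩ h
        obtain ⟨h1, h2⟩ := Prod.mk.inj h
        obtain ⟨h3, h4⟩ := Sigma.mk.inj h1
        change k = l at h3
        subst h3
        congr 1
        rw [← Fin.cons_self_tail a, ← Fin.cons_self_tail b]
        exact congrArg₂ _ h2 (eq_of_heq h4)
      · rintro ⟨⟨k, a⟩, i⟩
        exact ⟨⟨k, Fin.cons i a⟩, rfl⟩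
      · funext s
        exact (hg (⟨s.1, Fin.tail s.2⟩, s.2 0)).symm
    refine ⟨K, inferInstance, E, ?_, ?_⟩
    · rw [hφg]
      exact hgo.comp φ hφ.1
    · rw [hφg, hφ.2.range_comp]

/-- General `V` is needed because the hypothesis for `d` operators is applied to `C w₀`. For fixed
`d`, a block subspace is split off and the dimension of the rest drops. -/
theorem hasTensorBlocks_of_isReducing {d : ℕ} (A : Fin d → H →L[ℂ] H)
    (hA : ∀ i j, i ≠ j → A i * A j = A j * A i ∧ star (A i) * A j = A j * star (A i))
    (V : Submodule ℂ H) (hV : ∀ j, IsReducing V (A j)) : HasTensorBlocks A V := by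
  induction d generalizing V with
  | zero => exact hasTensorBlocks_zero A V
  | succ d ih =>
    have ih' := ih (fun j => A j.succ) fun i j hij =>
      hA _ _ fun h => hij (Fin.succ_injective _ h)
    induction hm : Module.finrank ℂ V using Nat.strong_induction_on generalizing V with
    | _ m ihm =>
      by_cases hV0 : V = ⊥
      · rw [hV0]
        exact hasTensorBlocks_bot A
      · obtain ⟨V₁, hle, hne, hred, hblocks⟩ :=
          exists_reducing_hasTensorBlocks A hA ih' V hV hV0
        have hlt : V₁ᗮ ⊓ V < V := by
          refine lt_of_le_of_ne inf_le_right fun h => hne ?_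
          have h1 : V ≤ V₁ᗮ := inf_eq_right.1 h
          rw [Submodule.eq_bot_iff]
          intro x hx
          have h2 := (Submodule.mem_orthogonal _ _).1 (h1 (hle hx)) x hx
          exact inner_self_eq_zero.1 h2
        have h2 := ihm _ (hm ▸ Submodule.finrank_lt_finrank_of_lt hlt) (V₁ᗮ ⊓ V)
          (fun j => (hred j).orthogonal.inf (hV j)) rfl
        have h3 := hblocks.sup h2 inf_le_left
        rwa [Submodule.sup_orthogonal_inf_of_hasOrthogonalProjection hle] at h3

end Existence

/-! ### From tensor blocks to matrices -/

theorem nonempty_BRDecomposition {n d : ℕ} (A : Fin d → Matrix (Fin n) (Fin n) ℂ)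
    (hA : DoublyCommuting A) : Nonempty (BRDecomposition A) := by
  obtain ⟨K, _, D, hD, hspan⟩ := hasTensorBlocks_of_isReducing
    (fun j => Matrix.toEuclideanCLM (𝕜 := ℂ) (A j)) (fun i j hij => by
      obtain ⟨h1, h2⟩ := hA i j hij
      refine ⟨by rw [← map_mul, h1, map_mul], ?_⟩
      rw [← map_star, ← map_mul, ← map_mul]
      exact congrArg _ h2) ⊤ fun j => ⟨fun _ _ => trivial, fun _ _ => trivial⟩
  obtain ⟨σ⟩ : Nonempty (Fin (Fintype.card K) ≃ K) := ⟨(Fintype.equivFin K).symm⟩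
  obtain ⟨v, hv⟩ : ∃ v : (Σ k : Fin (Fintype.card K), ∀ j : Fin d, Fin ((D (σ k)).p j)) →
      EuclideanSpace ℂ (Fin n), ∀ s, v s = (D (σ s.1)).v s.2 := ⟨_, fun _ => rfl⟩
  obtain ⟨φ, hφ, hφv⟩ : ∃ φ : (Σ k : Fin (Fintype.card K), ∀ j : Fin d, Fin ((D (σ k)).p j)) →
      (Σ k, ∀ j, Fin ((D k).p j)), Function.Bijective φ ∧ v = blockVectors D ∘ φ := by
    refine ⟨fun s => ⟨σ s.1, s.2⟩, ⟨?_, ?_⟩, funext hv⟩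
    · rintro ⟨k, a⟩ ⟨l, b⟩ h
      obtain ⟨h1, h2⟩ := Sigma.mk.inj h
      have h3 : k = l := σ.injective h1
      subst h3
      exact congrArg _ (eq_of_heq h2)
    · rintro ⟨k, a⟩
      obtain ⟨l, rfl⟩ := σ.surjective k
      exact ⟨⟨l, a⟩, rfl⟩
  have hvo : Orthonormal ℂ v := by
    rw [hφv]
    exact hD.comp φ hφ.1
  have hvspan : Submodule.span ℂ (Set.range v) = ⊤ := by
    rw [hφv, hφ.2.range_comp, hspan]
  have hcard : Fintype.card (Fin n) =
      Fintype.card (Σ k : Fin (Fintype.card K), ∀ j : Fin d, Fin ((D (σ k)).p j)) := by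
    have h := Module.finrank_eq_card_basis (OrthonormalBasis.mk hvo hvspan.ge).toBasis
    rw [finrank_euclideanSpace] at h
    exact h
  obtain ⟨e⟩ := Fintype.card_eq.1 hcard
  have hinner : ∀ x y : EuclideanSpace ℂ (Fin n), ⟪x, y⟫_ℂ = ∑ m, (starRingEnd ℂ) (x m) * y m :=
    fun x y => by
      rw [PiLp.inner_apply]
      exact Finset.sum_congr rfl fun m _ => by rw [RCLike.inner_apply, mul_comm]
  -- These inner products will be the entries of `U A_j U*`.
  have hact : ∀ j s t, ⟪v s, Matrix.toEuclideanCLM (𝕜 := ℂ) (A j) (v t)⟫_ℂ =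
      Matrix.blockDiagonal' (fun k => kroneckerAt j ((D (σ k)).X j)) s t := by
    classical
    rintro j ⟨k, a⟩ ⟨l, b⟩
    have h1 : Matrix.toEuclideanCLM (𝕜 := ℂ) (A j) (v ⟨l, b⟩) =
        ∑ c, (D (σ l)).X j c (b j) • v ⟨l, Function.update b j c⟩ := by
      simp only [hv]
      exact (D (σ l)).act j b
    rw [h1, inner_sum]
    simp only [inner_smul_right, orthonormal_iff_ite.1 hvo]
    by_cases hkl : k = l
    · subst hkl
      rw [Matrix.blockDiagonal'_apply_eq, kroneckerAt_apply]
      have hupd : ∀ c, (⟨k, a⟩ : Σ k : Fin (Fintype.card K), ∀ j : Fin d, Fin ((D (σ k)).p j)) =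
          ⟨k, Function.update b j c⟩ ↔ c = a j ∧ ∀ i, i ≠ j → a i = b i := fun c => by
        rw [Sigma.mk.injEq, heq_eq_eq, eq_comm (a := a), Function.update_eq_iff]
        simp only [true_and]
        refine and_congr_right fun _ => forall₂_congr fun i _ => eq_comm
      simp only [hupd]
      split_ifs with hab
      · simp only [and_iff_left hab, mul_ite, mul_one, mul_zero]
        simp
      · simp [hab]
    · rw [Matrix.blockDiagonal'_apply_ne _ _ _ hkl]
      refine Finset.sum_eq_zero fun c _ => ?_
      rw [if_neg fun h => hkl (congrArg Sigma.fst h), mul_zero]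
  refine ⟨{
    l := Fintype.card K
    p := fun k => (D (σ k)).p
    p_pos := fun k => (D (σ k)).p_pos
    X := fun j k => (D (σ k)).X j
    -- Row `i` is the conjugate of a basis vector, so `U` sends `v (e i)` to the `i`-th standard
    -- vector.
    U := Matrix.of fun i m => (starRingEnd ℂ) (v (e i) m)
    U_unitary := ?_
    e := e
    eq_blockDiagonal := fun j => ?_ }⟩
  · classical
    rw [Matrix.mem_unitaryGroup_iff]
    ext i i'
    rw [Matrix.mul_apply, Matrix.one_apply]
    have h := orthonormal_iff_ite.1 hvo (e i) (e i')
    rw [hinner] at h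
    simp only [e.injective.eq_iff] at h
    rw [← h]
    refine Finset.sum_congr rfl fun m _ => ?_
    simp [Matrix.star_apply]
  · ext s t
    rw [← hact, hinner, Matrix.reindex_apply, Matrix.submatrix_apply, Matrix.mul_assoc,
      Matrix.mul_apply]
    refine Finset.sum_congr rfl fun m _ => ?_
    rw [Matrix.of_apply, e.apply_symm_apply, Matrix.mul_apply]
    congr 1
    change _ = ∑ m', A j m m' * v t m'
    refine Finset.sum_congr rfl fun m' _ => ?_
    simp

theorem lemma3 (n d : ℕ) (A : Fin d → Matrix (Fin n) (Fin n) ℂ) (hA : DoublyCommuting A) :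
    Convex ℝ (maximalRange A) ∧
    Nonempty (BRDecomposition A) ∧
    ∀ D : BRDecomposition A,
      maximalRange A =
        convexHull ℝ
          (⋃ k ∈ {k : Fin D.l |
              ∑ j, ‖Matrix.toEuclideanCLM (𝕜 := ℂ) (D.X j k)‖ ^ 2 = ‖tupleOp A‖ ^ 2},
            Set.univ.pi fun j => maximalRangeSingle (D.X j k)) := by
  obtain ⟨D₀⟩ := nonempty_BRDecomposition A hA
  refine ⟨?_, ⟨D₀⟩, fun D => D.maximalRange_eq⟩
  rw [D₀.maximalRange_eq]
  exact convex_convexHull ℝ _
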